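/- Let $\Gamma=\langle a,b\rangle$ be the free group of rank two, i.e. the fundamental group of a once-punctured torus $\mathbb T$. For $g,h\in\Gamma$ write $g\sim h$ if $g$ is conjugate to $h$ or to $h^{-1}$, and let $\hat\Omega\subset\Gamma/{\sim}$ be the set of classes of nontrivial, nonperipheral simple closed curves on $\mathbb T$, that is, the classes of the elements of $\Gamma$ that belong to some pair of free generators. For $\tau\in\mathbb C$, a homomorphism $\rho:\Gamma\to\mathrm{SL}(2,\mathbb C)$ is a $\tau$-representation if $\operatorname{tr}\rho(aba^{-1}b^{-1})=\tau$ for some (hence every) pair of free generators $a,b$ of $\Gamma$. It satisfies the BQ-conditions if $\operatorname{tr}\rho(g)\notin[-2,2]$ for all $[g]\in\hat\Omega$, and $|\operatorname{tr}\rho(g)|\le 2$ for only finitely many $[g]\in\hat\Omega$. Let $\cosh^{-1}$ be the branch with nonnegative real part and imaginary part in $(-\pi,\pi]$ (the imaginary part being nonnegative when the real part is $0$), and let $\log$ be the branch with imaginary part in $(-\pi,\pi]$. For $\tau\in\mathbb C$ put $\nu=\cosh^{-1}(-\tau/2)$ and, for $x\in\mathbb C$ with $x^2\ne\tau+2$,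 $$\mathfrak h_\tau(x)=\log\frac{e^{\nu}+e^{l(x)}}{e^{-\nu}+e^{l(x)}},\qquad l(x)=2\cosh^{-1}(x/2).$$ **Theorem.** (1) Let $\rho:\Gamma\to\mathrm{SL}(2,\mathbb C)$ be a $\tau$-representation with $\tau\neq2$ that satisfies the BQ-conditions, and let $\nu=\cosh^{-1}(-\tau/2)$. Then $(\operatorname{tr}\rho(g))^2\ne\tau+2$ for all $[g]\in\hat\Omega$, and $$\sum_{[g]\in\hat\Omega}\mathfrak h_\tau(\operatorname{tr}\rho(g))=\nu \mod 2\pi i,$$ where the sum converges absolutely. (2) Let $\Omega$ be the set of complementary regions of the trivalent tree $\Sigma$ dual to the Farey triangulation of the hyperbolic plane, identified with the set $\mathbb Q\cup\{\infty\}$ of Farey vertices; $p/q$ and $r/s$ (in lowest terms, $\infty=1/0$) are Farey neighbours if $ps-rq=\pm1$. Three regions meet at a vertex of $\Sigma$ if and only if they are pairwise Farey neighbours. A $\mu$-Markoff map is a function $\phi:\Omega\to\mathbb C$ such that, writing $x=\phi(X)$ and so on, $x^2+y^2+z^2-xyz=\mu$ whenever $X,Y,Z$ meet at a vertex, and $xy=z+w$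 whenever $X,Y$ are the two regions along an edge of $\Sigma$ and $Z\ne W$ are the two regions at its ends. Suppose $\mu\ne0,4$ and that $\phi$ is a $\mu$-Markoff map satisfying the BQ-conditions: $\phi(X)\notin[-2,2]$ for all $X\in\Omega$, and $|\phi(X)|\le2$ for only finitely many $X\in\Omega$. Then $\phi(X)^2\neq\mu$ for all $X\in\Omega$, and $$\sum_{X\in\Omega}\mathfrak h_{\mu-2}(\phi(X))=\nu\mod 2\pi i,\qquad \nu=\cosh^{-1}(1-\mu/2),$$ where the sum converges absolutely. -/

import Mathlib

namespace PuncturedTorus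

noncomputable section

/-! ### The functions `cosh⁻¹`, `ν` and `𝔥` -/

/-- The branch of the inverse hyperbolic cosine on `ℂ` with values of nonnegative real part and
of imaginary part in `(-π, π]`; where the real part vanishes, the imaginary part is taken
nonnegative. These properties, which determine the value, are proved right below. -/
def arcosh (z : ℂ) : ℂ :=
  Complex.log (z + (z - 1) ^ (1 / 2 : ℂ) * (z + 1) ^ (1 / 2 : ℂ))

theorem sq_cpow_half (w : ℂ) : (w ^ (1 / 2 : ℂ)) ^ 2 = w := by
  have h := Complex.cpow_nat_inv_pow w (n := 2) (by norm_num)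
  rw [one_div]
  exact_mod_cast h

theorem cpow_half_re (w : ℂ) : 0 ≤ (w ^ (1 / 2 : ℂ)).re ∧
    ((w ^ (1 / 2 : ℂ)).re = 0 → 0 ≤ (w ^ (1 / 2 : ℂ)).im) := by
  by_cases h : w = 0
  · simp [h]
  rw [Complex.cpow_def_of_ne_zero h, Complex.exp_re, Complex.exp_im]
  have h1 := Complex.neg_pi_lt_arg w
  have h2 := Complex.arg_le_pi w
  have e : (Complex.log w * (1 / 2)).im = w.arg / 2 := by
    rw [show (1 / 2 : ℂ) = ((1 / 2 : ℝ) : ℂ) by norm_num, Complex.im_mul_ofReal, Complex.log_im]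
    ring
  rw [e]
  have hc : 0 ≤ Real.cos (w.arg / 2) :=
    Real.cos_nonneg_of_mem_Icc ⟨by linarith, by linarith⟩
  refine ⟨by positivity, fun h0 => ?_⟩
  have : ¬ (w.arg / 2 < Real.pi / 2) := fun h3 => by
    have := Real.cos_pos_of_mem_Ioo (x := w.arg / 2) ⟨by linarith, h3⟩
    have := mul_pos (Real.exp_pos (Complex.log w * (1 / 2)).re) this
    linarith
  have : 0 ≤ Real.sin (w.arg / 2) := Real.sin_nonneg_of_nonneg_of_le_pi
    (by linarith [Real.pi_pos]) (by linarith [Real.pi_pos])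
  positivity

theorem arcosh_mul_aux (z : ℂ) :
    (z + (z - 1) ^ (1 / 2 : ℂ) * (z + 1) ^ (1 / 2 : ℂ)) *
      (z - (z - 1) ^ (1 / 2 : ℂ) * (z + 1) ^ (1 / 2 : ℂ)) = 1 := by
  have h1 := sq_cpow_half (z - 1)
  have h2 := sq_cpow_half (z + 1)
  linear_combination (-(z + 1)) * h1 - ((z - 1) ^ (1 / 2 : ℂ)) ^ 2 * h2

theorem exp_arcosh (z : ℂ) :
    Complex.exp (arcosh z) = z + (z - 1) ^ (1 / 2 : ℂ) * (z + 1) ^ (1 / 2 : ℂ) :=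
  Complex.exp_log (left_ne_zero_of_mul_eq_one (arcosh_mul_aux z))

theorem exp_neg_arcosh (z : ℂ) :
    Complex.exp (-arcosh z) = z - (z - 1) ^ (1 / 2 : ℂ) * (z + 1) ^ (1 / 2 : ℂ) := by
  rw [Complex.exp_neg, exp_arcosh]
  exact inv_eq_of_mul_eq_one_right (arcosh_mul_aux z)

theorem cosh_arcosh (z : ℂ) : Complex.cosh (arcosh z) = z := by
  rw [Complex.cosh, exp_neg_arcosh, exp_arcosh]
  ring

theorem arcosh_im_mem (z : ℂ) : (arcosh z).im ∈ Set.Ioc (-Real.pi) Real.pi :=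
  ⟨Complex.neg_pi_lt_log_im _, Complex.log_im_le_pi _⟩

theorem arcosh_re_nonneg (z : ℂ) : 0 ≤ (arcosh z).re := by
  have h1 := sq_cpow_half (z - 1)
  have h2 := sq_cpow_half (z + 1)
  obtain ⟨a0, a1⟩ := cpow_half_re (z - 1)
  obtain ⟨b0, b1⟩ := cpow_half_re (z + 1)
  have hm := arcosh_mul_aux z
  unfold arcosh
  set a := (z - 1) ^ (1 / 2 : ℂ)
  set b := (z + 1) ^ (1 / 2 : ℂ)
  have hz : z = (a ^ 2 + b ^ 2) / 2 := by rw [h1, h2]; ring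
  have e1 : z + a * b = (a + b) ^ 2 / 2 := by rw [hz]; ring
  have e2 : z - a * b = (a - b) ^ 2 / 2 := by rw [hz]; ring
  have him : a.re * a.im = b.re * b.im := by
    have := congrArg Complex.im (show a ^ 2 + 1 = b ^ 2 - 1 by rw [h1, h2]; ring)
    simp [sq] at this
    linarith
  have hab : 0 ≤ a.re * b.re + a.im * b.im := by
    rcases a0.eq_or_lt with ha | ha
    · have ha' := a1 ha.symm
      rw [← ha] at him ⊢
      rcases b0.eq_or_lt with hb | hb
      · have := b1 hb.symm
        nlinarith [mul_nonneg ha' this]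
      · have : b.im = 0 := by
          have h3 : b.re * b.im = 0 := by linarith
          exact (mul_eq_zero.mp h3).resolve_left hb.ne'
        simp [this]
    · rcases b0.eq_or_lt with hb | hb
      · have hb' := b1 hb.symm
        rw [← hb] at him ⊢
        have : a.im = 0 := by
          have h3 : a.re * a.im = 0 := by linarith
          exact (mul_eq_zero.mp h3).resolve_left ha.ne'
        simp [this]
      · have h3 : 0 ≤ a.im * b.im := by
          have h4 : b.re * (a.im * b.im) = a.re * a.im ^ 2 := by
            linear_combination -a.im * him
          have h5 : 0 ≤ a.re * a.im ^ 2 := by positivity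
          rw [← h4] at h5
          exact nonneg_of_mul_nonneg_right h5 hb
        positivity
  have hle : ‖a - b‖ ^ 2 ≤ ‖a + b‖ ^ 2 := by
    rw [← Complex.normSq_eq_norm_sq, ← Complex.normSq_eq_norm_sq, Complex.normSq_apply,
      Complex.normSq_apply]
    simp only [Complex.add_re, Complex.add_im, Complex.sub_re, Complex.sub_im]
    nlinarith
  have hle' : ‖z - a * b‖ ≤ ‖z + a * b‖ := by
    rw [e1, e2, norm_div, norm_div, norm_pow, norm_pow]
    gcongr
  have hn : ‖z + a * b‖ * ‖z - a * b‖ = 1 := by rw [← norm_mul, hm, norm_one]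
  rw [Complex.log_re]
  apply Real.log_nonneg
  by_contra! hlt
  nlinarith [norm_nonneg (z + a * b), norm_nonneg (z - a * b)]

theorem arcosh_im_nonneg (z : ℂ) (h0 : (arcosh z).re = 0) : 0 ≤ (arcosh z).im := by
  have hz : z = ((Real.cos (arcosh z).im : ℝ) : ℂ) := by
    have e : arcosh z = ((arcosh z).im : ℂ) * Complex.I := by
      apply Complex.ext <;> simp [h0]
    conv_lhs => rw [← cosh_arcosh z, e, Complex.cosh_mul_I, ← Complex.ofReal_cos]
  have hr : z.re = Real.cos (arcosh z).im := by
    conv_lhs => rw [hz, Complex.ofReal_re]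
  have hi : z.im = 0 := by rw [hz, Complex.ofReal_im]
  have hc1 := Real.cos_le_one (arcosh z).im
  have hc2 := Real.neg_one_le_cos (arcosh z).im
  rw [← hr] at hc1 hc2
  have h1 := sq_cpow_half (z - 1)
  have h2 := sq_cpow_half (z + 1)
  obtain ⟨a0, a1⟩ := cpow_half_re (z - 1)
  obtain ⟨b0, b1⟩ := cpow_half_re (z + 1)
  have him : (arcosh z).im = (z + (z - 1) ^ (1 / 2 : ℂ) * (z + 1) ^ (1 / 2 : ℂ)).arg :=
    Complex.log_im _
  rw [him, Complex.arg_nonneg_iff]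
  set a := (z - 1) ^ (1 / 2 : ℂ)
  set b := (z + 1) ^ (1 / 2 : ℂ)
  have ar := congrArg Complex.re h1
  have ai := congrArg Complex.im h1
  have br := congrArg Complex.re h2
  have bi := congrArg Complex.im h2
  simp [sq, hi] at ar ai br bi
  have ha : a.re = 0 := by
    by_contra h
    have h3 : a.im = 0 := by
      have : a.re * a.im = 0 := by linarith
      exact (mul_eq_zero.mp this).resolve_left h
    rw [h3] at ar
    have : 0 < a.re * a.re := mul_self_pos.mpr h
    linarith
  have hb : b.im = 0 := by
    by_contra h
    have h3 : b.re = 0 := by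
      have : b.re * b.im = 0 := by linarith
      exact (mul_eq_zero.mp this).resolve_right h
    rw [h3] at br
    have : 0 < b.im * b.im := mul_self_pos.mpr h
    linarith
  have := a1 ha
  simp only [Complex.add_im, Complex.mul_im, hi, ha, hb]
  nlinarith [mul_nonneg this b0]

/-- `ν = cosh⁻¹(-τ/2)`. -/
def nu (τ : ℂ) : ℂ := arcosh (-τ / 2)

/-- The complex length `l(x) = 2 cosh⁻¹(x/2)`; it matters only modulo `2πi`. -/
def len (x : ℂ) : ℂ := 2 * arcosh (x / 2)

/-- `𝔥_τ(x) = log ((e^ν + e^{l(x)}) / (e^{-ν} + e^{l(x)}))`, with the principal logarithm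
(imaginary part in `(-π, π]`); it is meaningful for `x² ≠ τ + 2`. -/
def gap (τ x : ℂ) : ℂ :=
  Complex.log ((Complex.exp (nu τ) + Complex.exp (len x)) /
    (Complex.exp (-nu τ) + Complex.exp (len x)))

/-! ### The punctured torus group, its simple closed curves and its representations -/

/-- The fundamental group of the once-punctured torus: the free group of rank two. -/
abbrev Gam : Type := FreeGroup (Fin 2)

/-- `a, b` is a pair of free generators of the group. -/
def IsFreePair (a b : Gam) : Prop :=
  Function.Bijective (FreeGroup.lift ![a, b] : FreeGroup (Fin 2) →* Gam)

/-- `g ~ h` if and only if `g` is conjugate to `h` or to `h⁻¹`. -/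
def curveSetoid : Setoid Gam where
  r g h := IsConj g h ∨ IsConj g h⁻¹
  iseqv :=
    { refl := fun g => Or.inl (IsConj.refl g)
      symm := by
        have key : ∀ {g h : Gam}, IsConj g h → IsConj g⁻¹ h⁻¹ := by
          intro g h hc
          obtain ⟨c, hc⟩ := isConj_iff.mp hc
          exact isConj_iff.mpr ⟨c, by rw [← hc]; group⟩
        rintro g h (hc | hc)
        · exact Or.inl hc.symm
        · exact Or.inr (by simpa using key hc.symm)
      trans := by
        have key : ∀ {g h : Gam}, IsConj g h → IsConj g⁻¹ h⁻¹ := by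
          intro g h hc
          obtain ⟨c, hc⟩ := isConj_iff.mp hc
          exact isConj_iff.mpr ⟨c, by rw [← hc]; group⟩
        rintro g h k (h1 | h1) (h2 | h2)
        · exact Or.inl (h1.trans h2)
        · exact Or.inr (h1.trans h2)
        · exact Or.inr (h1.trans (key h2))
        · exact Or.inl (h1.trans (by simpa using key h2)) }

/-- `Γ/~`: the free homotopy classes of unoriented closed curves on the punctured torus. -/
abbrev CurveClass : Type := Quotient curveSetoid

/-- The classes of the nontrivial, nonperipheral simple closed curves on the punctured torus.
In `Γ/~` they are the classes of the primitive elements of the free group, that is, of the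
elements that belong to a pair of free generators. -/
def simpleClasses : Set CurveClass :=
  {c | ∃ a b : Gam, IsFreePair a b ∧ c = Quotient.mk curveSetoid a}

/-- The trace of `ρ` on a class of `Γ/~`. -/
def classTrace (ρ : Gam →* Matrix.SpecialLinearGroup (Fin 2) ℂ) : CurveClass → ℂ :=
  Quotient.lift (fun g => (ρ g : Matrix (Fin 2) (Fin 2) ℂ).trace) (by
    have conj : ∀ g h : Gam, IsConj g h →
        (ρ g : Matrix (Fin 2) (Fin 2) ℂ).trace = (ρ h : Matrix (Fin 2) (Fin 2) ℂ).trace := by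
      intro g h hc
      obtain ⟨c, rfl⟩ := isConj_iff.mp hc
      rw [map_mul, map_mul, Matrix.SpecialLinearGroup.coe_mul, Matrix.trace_mul_comm,
        ← Matrix.SpecialLinearGroup.coe_mul, ← mul_assoc, ← map_mul, inv_mul_cancel, map_one,
        one_mul]
    have inv : ∀ g : Gam, (ρ g⁻¹ : Matrix (Fin 2) (Fin 2) ℂ).trace =
        (ρ g : Matrix (Fin 2) (Fin 2) ℂ).trace := by
      intro g
      rw [map_inv, Matrix.SpecialLinearGroup.coe_inv, Matrix.adjugate_fin_two,
        Matrix.trace_fin_two, Matrix.trace_fin_two]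
      simp [add_comm]
    rintro g h (hc | hc)
    · exact conj g h hc
    · exact (conj g h⁻¹ hc).trans (inv h))

/-- `ρ` is a `τ`-representation: `tr ρ([a,b]) = τ` for some pair of free generators. -/
def IsTauRep (τ : ℂ) (ρ : Gam →* Matrix.SpecialLinearGroup (Fin 2) ℂ) : Prop :=
  ∃ a b : Gam, IsFreePair a b ∧
    (ρ (a * b * a⁻¹ * b⁻¹) : Matrix (Fin 2) (Fin 2) ℂ).trace = τ

/-- The real segment `[-2, 2]` in `ℂ`. -/
def realSegment : Set ℂ := {z | ∃ t : ℝ, -2 ≤ t ∧ t ≤ 2 ∧ z = (t : ℂ)}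

/-- The BQ-conditions for a representation. -/
def RepBQ (ρ : Gam →* Matrix.SpecialLinearGroup (Fin 2) ℂ) : Prop :=
  (∀ c ∈ simpleClasses, classTrace ρ c ∉ realSegment) ∧
    {c | c ∈ simpleClasses ∧ ‖classTrace ρ c‖ ≤ 2}.Finite

/-! ### The Farey tessellation and generalized Markoff maps -/

/-- The complementary regions of the trivalent tree dual to the Farey triangulation, that is, the
vertices `ℚ ∪ {∞}` of the Farey triangulation. -/
abbrev Region : Type := OnePoint ℚ

/-- The numerator of `p/q ∈ ℚ ∪ {∞}` in lowest terms, with `∞ = 1/0`. -/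
def Region.num : Region → ℤ
  | none => 1
  | some r => r.num

/-- The denominator of `p/q ∈ ℚ ∪ {∞}` in lowest terms, with `∞ = 1/0`. -/
def Region.den : Region → ℤ
  | none => 0
  | some r => r.den

/-- `p/q` and `r/s` are Farey neighbours: `ps - rq = ±1`. Equivalently, the two regions share an
edge of the tree. -/
def FareyAdj (X Y : Region) : Prop :=
  Region.num X * Region.den Y - Region.num Y * Region.den X = 1 ∨
    Region.num X * Region.den Y - Region.num Y * Region.den X = -1

/-- The regions `X, Y, Z` meet at a vertex of the tree, that is, they span a Farey triangle. -/
def MeetAtVertex (X Y Z : Region) : Prop :=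
  FareyAdj X Y ∧ FareyAdj Y Z ∧ FareyAdj Z X

/-- `(X, Y; Z, W)` is an edge of the tree: `X` and `Y` are the regions along the edge, `Z` and `W`
the ones at its two ends. -/
def IsEdge (X Y Z W : Region) : Prop :=
  MeetAtVertex X Y Z ∧ MeetAtVertex X Y W ∧ Z ≠ W

/-- `φ` is a `μ`-Markoff map: the vertex and the edge relations hold. -/
def IsMarkoffMap (μ : ℂ) (φ : Region → ℂ) : Prop :=
  (∀ X Y Z, MeetAtVertex X Y Z →
      φ X ^ 2 + φ Y ^ 2 + φ Z ^ 2 - φ X * φ Y * φ Z = μ) ∧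
    ∀ X Y Z W, IsEdge X Y Z W → φ X * φ Y = φ Z + φ W

/-- The BQ-conditions for a generalized Markoff map. -/
def MarkoffBQ (φ : Region → ℂ) : Prop :=
  (∀ X, φ X ∉ realSegment) ∧ {X | ‖φ X‖ ≤ 2}.Finite

end

end PuncturedTorus

open PuncturedTorus

/-! Put μ = τ + 2 and E = e^ν. For a directed edge of the tree with side values x, y and value z
behind it, let P = 1 + (E - 1)z/(xy). For a region with value x = λ + λ⁻¹, |λ| ≥ 1, let Q(x) = (E +
λ²)/(λ² + 1). The claim that carries the proof, `IsGood`, is that the gaps of the regions beyond the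
edge converge absolutely and exp(their sum) · Q(x)Q(y) = P. Since the theorem holds only modulo 2πi,
everything stays multiplicative and no branch of the logarithm has to be followed.

Algebra. If w is the value ahead, then P · (1 - μ/w²) is the product of the P of the two continuing
edges (`edgeFactor_child`), and Q(w)² = (1 - μ/w²) exp(gap of w) (`sideFactor_sq`). So the claim
passes from the continuing edges to the edge. For opposite edges the two P multiply to E(1 - μ/x²)(1
- μ/y²), which turns the two claims into the total e^ν.

Analysis. The defect `ratio` of the claim is multiplicative over continuing edges. For an edge with
large sides that points away from smaller values, it is within O(|xy|⁻²) of 1, and this weight at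
least halves in total at each level, so the defect is 1 (`Outward.ratio_eq_one`). If the claim
failed anywhere, it would fail along an infinite path. A path around a single region meets good
edges: the values grow geometrically there by the BQ-conditions, and the defect becomes constant
with limit 1 (`exists_fan_isGood`). On a path turning both ways forever the side values eventually
exceed 2 in modulus, the path cannot descend forever because μ ≠ 4 (`IsPath.not_descending`), and
once it ascends the values grow beyond any bound.

Combinatorics. The regions are the two sides of an edge and the binary words beyond it in both
directions. The Stern–Brocot process matches them with ℚ ∪ {∞}. For the group, Nielsen's theorem in
rank two shows that every primitive class is represented by a word of the tree, homology tells these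
words apart, and trace identities make the traces of ρ the values on the tree. -/

namespace PuncturedTorus

/-! ### Directed edges, multipliers and the algebra of gaps. -/

open Filter Topology

noncomputable section

/-! ### Sums over binary words -/

/-- A binary word is empty, or starts with `false`, or starts with `true`. -/
def wordEquiv : Unit ⊕ (List Bool ⊕ List Bool) ≃ List Bool where
  toFun
    | Sum.inl _ => []
    | Sum.inr (Sum.inl w) => false :: w
    | Sum.inr (Sum.inr w) => true :: w
  invFun
    | [] => Sum.inl ()
    | false :: w => Sum.inr (Sum.inl w)
    | true :: w => Sum.inr (Sum.inr w)
  left_inv := by rintro (_ | _ | _) <;> rfl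
  right_inv := by
    intro w
    match w with
    | [] => rfl
    | false :: w => rfl
    | true :: w => rfl

theorem hasSum_words {M : Type*} [AddCommMonoid M] [TopologicalSpace M] [ContinuousAdd M]
    {f : List Bool → M} {a b : M} (ha : HasSum (fun w => f (false :: w)) a)
    (hb : HasSum (fun w => f (true :: w)) b) : HasSum f (f [] + (a + b)) := by
  rw [← wordEquiv.hasSum_iff]
  refine HasSum.sum ?_ (HasSum.sum ha hb)
  have := hasSum_unique (fun _ : Unit => f [])
  exact this

theorem summable_words {f : List Bool → ℝ} (ha : Summable (fun w => f (false :: w)))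
    (hb : Summable (fun w => f (true :: w))) : Summable f :=
  (hasSum_words ha.hasSum hb.hasSum).summable

/-- The words of length `< n`. -/
def shortWords : ℕ → Finset (List Bool)
  | 0 => ∅
  | n + 1 => insert [] ((shortWords n).map ⟨List.cons false, List.cons_injective⟩ ∪
      (shortWords n).map ⟨List.cons true, List.cons_injective⟩)

theorem mem_shortWords {n : ℕ} {w : List Bool} : w ∈ shortWords n ↔ w.length < n := by
  induction n generalizing w with
  | zero => simp [shortWords]
  | succ n ih =>
    match w with
    | [] => simp [shortWords]
    | false :: w => simp [shortWords, ih]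
    | true :: w => simp [shortWords, ih]

theorem sum_shortWords_succ (f : List Bool → ℝ) (n : ℕ) :
    ∑ w ∈ shortWords (n + 1), f w = f [] + (∑ w ∈ shortWords n, f (false :: w) +
      ∑ w ∈ shortWords n, f (true :: w)) := by
  rw [shortWords, Finset.sum_insert (by simp), Finset.sum_union]
  · simp
  · rw [Finset.disjoint_left]
    simp

/-- Every finite set of words consists of words of bounded length, so it suffices to bound the
truncations, which obey the recursion of the tree. -/
theorem hasSum_le_of_shortWords {f : List Bool → ℝ} {C : ℝ} (hf : ∀ w, 0 ≤ f w)
    (h : ∀ n, ∑ w ∈ shortWords n, f w ≤ C) : Summable f ∧ ∑' w, f w ≤ C := by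
  have key : ∀ s : Finset (List Bool), ∑ w ∈ s, f w ≤ C := by
    intro s
    refine le_trans (Finset.sum_le_sum_of_subset_of_nonneg (t := shortWords (s.sup List.length + 1))
      ?_ fun w _ _ => hf w) (h _)
    intro w hw
    rw [mem_shortWords, Nat.lt_succ_iff]
    exact Finset.le_sup (f := List.length) hw
  exact ⟨summable_of_sum_le hf key, Real.tsum_le_of_sum_le hf key⟩

/-! ### Directed edges of the tree and the values beyond them -/

/-- The values of a Markoff map around a directed edge: on the two regions along the edge and on
the region at its tail. -/
structure Edge where
  left : ℂ
  right : ℂ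
  back : ℂ

namespace Edge

/-- The value on the region at the head of the edge. -/
def front (e : Edge) : ℂ := e.left * e.right - e.back

/-- The two edges that continue an edge. -/
def child : Bool → Edge → Edge
  | false, e => ⟨e.left, e.front, e.right⟩
  | true, e => ⟨e.front, e.right, e.left⟩

/-- The values on the regions beyond the edge, which are indexed by binary words. -/
def val : Edge → List Bool → ℂ
  | e, [] => e.front
  | e, d :: w => val (child d e) w

/-- The mirror image of an edge. -/
def mirror (e : Edge) : Edge := ⟨e.right, e.left, e.back⟩

/-- The edge with the opposite direction. -/
def reverse (e : Edge) : Edge := ⟨e.left, e.right, e.front⟩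

@[simp] theorem val_nil (e : Edge) : e.val [] = e.front := rfl

@[simp] theorem val_cons (e : Edge) (d : Bool) (w : List Bool) :
    e.val (d :: w) = (e.child d).val w := rfl

theorem front_mirror (e : Edge) : e.mirror.front = e.front := by
  simp only [front, mirror]; ring

theorem child_mirror (e : Edge) (d : Bool) : e.mirror.child d = (e.child (!d)).mirror := by
  cases d <;> simp [child, front_mirror] <;> simp [mirror]

theorem val_mirror (e : Edge) (w : List Bool) : e.mirror.val w = e.val (w.map not) := by
  induction w generalizing e with
  | nil => exact e.front_mirror
  | cons d w ih => rw [val_cons, child_mirror, ih]; rfl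

theorem front_reverse (e : Edge) : e.reverse.front = e.back := by
  simp only [front, reverse]; ring

/-- The vertex relation at the tail of the edge. -/
def Vertex (μ : ℂ) (e : Edge) : Prop :=
  e.left ^ 2 + e.right ^ 2 + e.back ^ 2 - e.left * e.right * e.back = μ

theorem Vertex.child {μ : ℂ} {e : Edge} (h : e.Vertex μ) (d : Bool) :
    (e.child d).Vertex μ := by
  unfold Vertex at *
  cases d <;> simp only [Edge.child, front] <;> linear_combination h

theorem Vertex.mirror {μ : ℂ} {e : Edge} (h : e.Vertex μ) : e.mirror.Vertex μ := by
  unfold Vertex at *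
  simp only [Edge.mirror]; linear_combination h

theorem Vertex.reverse {μ : ℂ} {e : Edge} (h : e.Vertex μ) : e.reverse.Vertex μ := by
  unfold Vertex at *
  simp only [Edge.reverse, front]; linear_combination h

theorem Vertex.back_mul_front {μ : ℂ} {e : Edge} (h : e.Vertex μ) :
    e.back * e.front = e.left ^ 2 + e.right ^ 2 - μ := by
  unfold Vertex at h
  simp only [front]; linear_combination -h

end Edge

/-! ### The multiplier of a trace -/

/-- The multiplier `e^{l(x)/2}`, which satisfies `λ + λ⁻¹ = x`. -/
def lam (x : ℂ) : ℂ := Complex.exp (arcosh (x / 2))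

theorem lam_ne_zero (x : ℂ) : lam x ≠ 0 := Complex.exp_ne_zero _

theorem lam_add_inv (x : ℂ) : lam x + (lam x)⁻¹ = x := by
  have := cosh_arcosh (x / 2)
  rw [Complex.cosh] at this
  rw [lam, ← Complex.exp_neg]
  linear_combination 2 * this

theorem exp_len (x : ℂ) : Complex.exp (len x) = lam x ^ 2 := by
  rw [len, lam, ← Complex.exp_nat_mul]; norm_num

theorem lam_sq_add_one (x : ℂ) : lam x ^ 2 + 1 = lam x * x := by
  conv_rhs => rw [← lam_add_inv x]
  have := lam_ne_zero x
  rw [lam_add_inv]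
  have h := lam_add_inv x
  field_simp at h
  linear_combination h

theorem one_le_norm_lam (x : ℂ) : 1 ≤ ‖lam x‖ := by
  rw [lam, Complex.norm_exp]
  exact Real.one_le_exp (arcosh_re_nonneg _)

theorem norm_lam_inv_le (x : ℂ) : ‖(lam x)⁻¹‖ ≤ 1 := by
  rw [norm_inv]
  exact inv_le_one_of_one_le₀ (one_le_norm_lam x)

theorem norm_sub_one_le_norm_lam (x : ℂ) : ‖x‖ - 1 ≤ ‖lam x‖ := by
  have h := norm_add_le (lam x) (lam x)⁻¹
  rw [lam_add_inv] at h
  linarith [norm_lam_inv_le x]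

/-- Modulus one would make `arcosh (x / 2)` purely imaginary and x twice a real cosine. -/
theorem one_lt_norm_lam {x : ℂ} (hx : x ∉ realSegment) : 1 < ‖lam x‖ := by
  refine (one_le_norm_lam x).lt_of_ne fun h => hx ?_
  have h0 : (arcosh (x / 2)).re = 0 := by
    rw [lam, Complex.norm_exp] at h
    exact (Real.exp_eq_one_iff _).mp h.symm
  have e : arcosh (x / 2) = ((arcosh (x / 2)).im : ℂ) * Complex.I := by
    apply Complex.ext <;> simp [h0]
  have hc := cosh_arcosh (x / 2)
  rw [e, Complex.cosh_mul_I, ← Complex.ofReal_cos] at hc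
  refine ⟨2 * Real.cos (arcosh (x / 2)).im, ?_, ?_, ?_⟩
  · linarith [Real.neg_one_le_cos (arcosh (x / 2)).im]
  · linarith [Real.cos_le_one (arcosh (x / 2)).im]
  · push_cast at hc ⊢
    linear_combination (-2) * hc

theorem ne_zero_of_notMem {x : ℂ} (hx : x ∉ realSegment) : x ≠ 0 := by
  rintro rfl
  exact hx ⟨0, by norm_num, by norm_num, by simp⟩

theorem lam_sq_add_one_ne_zero {x : ℂ} (hx : x ≠ 0) : lam x ^ 2 + 1 ≠ 0 := by
  rw [lam_sq_add_one]; exact mul_ne_zero (lam_ne_zero x) hx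

/-! ### Gap factors -/

/-- `e^ν`. -/
def expNu (τ : ℂ) : ℂ := Complex.exp (nu τ)

theorem expNu_ne_zero (τ : ℂ) : expNu τ ≠ 0 := Complex.exp_ne_zero _

theorem expNu_add_inv (τ : ℂ) : expNu τ + (expNu τ)⁻¹ = -τ := by
  have := cosh_arcosh (-τ / 2)
  rw [Complex.cosh] at this
  rw [expNu, ← Complex.exp_neg, nu]
  linear_combination 2 * this

theorem expNu_sq (τ : ℂ) : expNu τ ^ 2 = -τ * expNu τ - 1 := by
  have h := expNu_add_inv τ
  have := expNu_ne_zero τ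
  field_simp at h
  linear_combination h

/-- The exponential of the gap. -/
def gapFactor (τ x : ℂ) : ℂ := (expNu τ + lam x ^ 2) / ((expNu τ)⁻¹ + lam x ^ 2)

theorem gap_eq (τ x : ℂ) : gap τ x = Complex.log (gapFactor τ x) := by
  rw [gap, gapFactor, exp_len, Complex.exp_neg, expNu]

/-- The contribution of a region to a side of an edge far away along its boundary. -/
def sideFactor (τ x : ℂ) : ℂ := 1 + (expNu τ - 1) / (lam x ^ 2 + 1)

/-- The contribution of an edge. -/
def edgeFactor (τ : ℂ) (e : Edge) : ℂ := 1 + (expNu τ - 1) * e.back / (e.left * e.right)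

/-- As λ² + 1 = λx, both sides equal λ⁴ - τλ² + 1. Hence numerator and denominator of the gap factor
vanish only if x² = τ + 2. -/
theorem lam_prod (τ x : ℂ) : (expNu τ + lam x ^ 2) * ((expNu τ)⁻¹ + lam x ^ 2) =
    lam x ^ 2 * (x ^ 2 - (τ + 2)) := by
  have h1 := expNu_add_inv τ
  have h2 := lam_sq_add_one x
  have h3 := mul_inv_cancel₀ (expNu_ne_zero τ)
  linear_combination h3 + lam x ^ 2 * h1 + (lam x ^ 2 + 1 + lam x * x) * h2

theorem gap_num_ne_zero {τ x : ℂ} (h : x ^ 2 ≠ τ + 2) : expNu τ + lam x ^ 2 ≠ 0 := fun h0 => by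
  have := lam_prod τ x
  rw [h0, zero_mul] at this
  exact (mul_ne_zero (pow_ne_zero 2 (lam_ne_zero x)) (sub_ne_zero.mpr h)) this.symm

theorem gap_den_ne_zero {τ x : ℂ} (h : x ^ 2 ≠ τ + 2) :
    (expNu τ)⁻¹ + lam x ^ 2 ≠ 0 := fun h0 => by
  have := lam_prod τ x
  rw [h0, mul_zero] at this
  exact (mul_ne_zero (pow_ne_zero 2 (lam_ne_zero x)) (sub_ne_zero.mpr h)) this.symm

theorem exp_gap {τ x : ℂ} (h : x ^ 2 ≠ τ + 2) : Complex.exp (gap τ x) = gapFactor τ x := by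
  rw [gap_eq, Complex.exp_log]
  exact div_ne_zero (gap_num_ne_zero h) (gap_den_ne_zero h)

theorem sideFactor_ne_zero {τ x : ℂ} (hx : x ≠ 0) (h : x ^ 2 ≠ τ + 2) : sideFactor τ x ≠ 0 := by
  have h1 := lam_sq_add_one_ne_zero hx
  have : sideFactor τ x = (expNu τ + lam x ^ 2) / (lam x ^ 2 + 1) := by
    rw [sideFactor]; field_simp; ring
  rw [this]
  exact div_ne_zero (gap_num_ne_zero h) h1

theorem sideFactor_sq {τ x : ℂ} (hx : x ≠ 0) (h : x ^ 2 ≠ τ + 2) :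
    sideFactor τ x ^ 2 = (1 - (τ + 2) / x ^ 2) * Complex.exp (gap τ x) := by
  have h1 := lam_sq_add_one_ne_zero hx
  have e1 : sideFactor τ x = (expNu τ + lam x ^ 2) / (lam x ^ 2 + 1) := by
    rw [sideFactor]; field_simp; ring
  have e2 : 1 - (τ + 2) / x ^ 2 =
      (expNu τ + lam x ^ 2) * ((expNu τ)⁻¹ + lam x ^ 2) / (lam x ^ 2 + 1) ^ 2 := by
    rw [lam_prod, lam_sq_add_one]
    have := lam_ne_zero x
    field_simp
  have h2 := gap_den_ne_zero h
  rw [exp_gap h, e1, e2, gapFactor]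
  generalize (expNu τ)⁻¹ + lam x ^ 2 = D at *
  field_simp

/-- The equation of E = e^ν reads (E - 1)² = -μE with μ = τ + 2, which reduces the quadratic term of
the product. The rest is zw = x² + y² - μ and z + w = xy, for the values z behind and w ahead. -/
theorem edgeFactor_child (τ : ℂ) {e : Edge} (hv : e.Vertex (τ + 2)) (hl : e.left ≠ 0)
    (hr : e.right ≠ 0) (hf : e.front ≠ 0) :
    edgeFactor τ e * (1 - (τ + 2) / e.front ^ 2) =
      edgeFactor τ (e.child false) * edgeFactor τ (e.child true) := by
  have h1 := hv.back_mul_front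
  have h2 : e.back = e.left * e.right - e.front := by simp [Edge.front]
  have h3 := expNu_sq τ
  simp only [edgeFactor, Edge.child]
  generalize e.front = w at *
  generalize e.left = x at *
  generalize e.right = y at *
  generalize expNu τ = E at *
  rw [h2] at h1 ⊢
  field_simp
  have hτ : τ = x ^ 2 + y ^ 2 - 2 - (x * y - w) * w := by linear_combination h1
  subst hτ
  linear_combination (-x * y) * h3

/-- By (E - 1)² = -μE and z + w = xy the product is E - μE · zw/(x²y²), which factors because zw =
x² + y² - μ. -/
theorem edgeFactor_mul_reverse (τ : ℂ) {e : Edge} (hv : e.Vertex (τ + 2)) (hl : e.left ≠ 0)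
    (hr : e.right ≠ 0) :
    edgeFactor τ e * edgeFactor τ e.reverse =
      expNu τ * (1 - (τ + 2) / e.left ^ 2) * (1 - (τ + 2) / e.right ^ 2) := by
  have h3 := expNu_sq τ
  unfold Edge.Vertex at hv
  simp only [edgeFactor, Edge.reverse, Edge.front]
  generalize e.left = x at *
  generalize e.right = y at *
  generalize e.back = z at *
  generalize expNu τ = E at *
  field_simp
  have hτ : τ = x ^ 2 + y ^ 2 + z ^ 2 - x * y * z - 2 := by linear_combination -hv
  subst hτ
  linear_combination (z * (x * y - z)) * h3

end

end PuncturedTorus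

/-! ### Edges with large values that point away from the smaller ones. -/

namespace PuncturedTorus

open Filter Topology

noncomputable section

/-! ### Estimates for large traces -/

/-- Uniform estimates for traces of modulus at least `K`, and for edges pointing away from the
small traces. -/
structure Large (τ : ℂ) (K C : ℝ) : Prop where
  four_le : 4 ≤ K
  nonneg : 0 ≤ C
  gap_le : ∀ x : ℂ, K ≤ ‖x‖ → ‖gap τ x‖ ≤ C / ‖x‖ ^ 2
  sq_ne : ∀ x : ℂ, K ≤ ‖x‖ → x ^ 2 ≠ τ + 2
  half_le : ∀ x : ℂ, K ≤ ‖x‖ → 1 / 2 ≤ ‖sideFactor τ x‖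
  edge_le : ∀ e : Edge, e.Vertex (τ + 2) → K ≤ ‖e.left‖ → K ≤ ‖e.right‖ → ‖e.back‖ ≤ ‖e.front‖ →
    ‖edgeFactor τ e - sideFactor τ e.left * sideFactor τ e.right‖ ≤
      C / (‖e.left‖ ^ 2 * ‖e.right‖ ^ 2)

theorem half_norm_le_lam {x : ℂ} (hx : 4 ≤ ‖x‖) : 3 / 4 * ‖x‖ ≤ ‖lam x‖ := by
  linarith [norm_sub_one_le_norm_lam x]

theorem norm_inv_lam_sq_add_one_le {x : ℂ} (hx : 4 ≤ ‖x‖) :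
    ‖1 / (lam x ^ 2 + 1)‖ ≤ 2 / ‖x‖ ^ 2 := by
  have h := half_norm_le_lam hx
  rw [lam_sq_add_one, norm_div, norm_mul, norm_one, div_le_div_iff₀ (by nlinarith) (by nlinarith)]
  nlinarith

/-- The back value of an edge, compared with the sum of the side contributions. -/
theorem edge_identity {x y z m n μ : ℂ} (hm : m ≠ 0) (hn : n ≠ 0) (hx : m + m⁻¹ = x)
    (hy : n + n⁻¹ = y) (hx0 : x ≠ 0) (hy0 : y ≠ 0) (hv : x ^ 2 + y ^ 2 + z ^ 2 - x * y * z = μ)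
    (hd : z - (m * n + (m * n)⁻¹) ≠ 0) :
    z / (x * y) - 1 / (m ^ 2 + 1) - 1 / (n ^ 2 + 1) =
      (μ - 4) / (z - (m * n + (m * n)⁻¹)) / (x * y) -
        2 * (1 / (m ^ 2 + 1)) * (1 / (n ^ 2 + 1)) := by
  have h1 : m ^ 2 + 1 = m * x := by rw [← hx]; field_simp
  have h2 : n ^ 2 + 1 = n * y := by rw [← hy]; field_simp
  -- For μ = 4 the vertex relation leaves z = m/n + n/m or z = mn + 1/(mn). In general z misses the
  -- first by μ - 4 divided by its difference from the second.
  have h3 : (z - (m * n⁻¹ + n * m⁻¹)) * (z - (m * n + (m * n)⁻¹)) = μ - 4 := by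
    rw [← hv, ← hx, ← hy]; field_simp; ring
  rw [← h3, mul_div_cancel_right₀ _ hd]
  have h4 : (m * n⁻¹ + n * m⁻¹) * (m * n) = m ^ 2 + n ^ 2 := by field_simp
  rw [h1, h2]
  field_simp
  linear_combination h1 + h2

theorem exists_large (τ : ℂ) : ∃ K C, Large τ K C := by
  set E := expNu τ with hE
  set M : ℝ := 1 + ‖τ‖ + ‖E‖ + ‖E⁻¹‖ with hM
  have hτ0 := norm_nonneg τ
  have hE0 := norm_nonneg E
  have hE1 := norm_nonneg E⁻¹
  have hM1 : 1 ≤ M := by linarith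
  have ht : ‖E - 1‖ ≤ M := by
    refine (norm_sub_le _ _).trans ?_
    rw [norm_one]; linarith
  have big : ∀ x : ℂ, 100 * M ≤ ‖x‖ → 10000 * M ≤ ‖x‖ ^ 2 := fun x hx => by nlinarith
  have q_le : ∀ x : ℂ, 100 * M ≤ ‖x‖ → ‖sideFactor τ x - 1‖ ≤ 1 / 2 := by
    intro x hx
    have h1 := norm_inv_lam_sq_add_one_le (x := x) (by linarith)
    have h2 := big x hx
    have : sideFactor τ x - 1 = (E - 1) * (1 / (lam x ^ 2 + 1)) := by
      rw [sideFactor, ← hE]; ring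
    rw [this, norm_mul]
    calc ‖E - 1‖ * ‖1 / (lam x ^ 2 + 1)‖ ≤ M * (2 / ‖x‖ ^ 2) := by gcongr
      _ ≤ 1 / 2 := by
        rw [mul_div_assoc', div_le_div_iff₀ (by linarith) (by norm_num)]
        linarith
  -- The constants are generous: the estimates give 12M for a gap and 12M² + 8M for an edge, and M ≥
  -- 1.
  refine ⟨100 * M, 100 * M ^ 2, by linarith, by positivity, ?_, ?_, ?_, ?_⟩
  · intro x hx
    have h2 := big x hx
    have hl := half_norm_le_lam (x := x) (by linarith)
    have hd : ‖x‖ ^ 2 / 8 ≤ ‖E⁻¹ + lam x ^ 2‖ := by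
      have h3 := norm_sub_le (E⁻¹ + lam x ^ 2) E⁻¹
      rw [add_sub_cancel_left, norm_pow] at h3
      nlinarith
    have hd0 : E⁻¹ + lam x ^ 2 ≠ 0 := by
      intro h0
      rw [h0, norm_zero] at hd
      linarith
    have e1 : gapFactor τ x = 1 + (E - E⁻¹) / (E⁻¹ + lam x ^ 2) := by
      rw [gapFactor, ← hE]
      generalize E⁻¹ = E' at *
      field_simp; ring
    have hz : ‖(E - E⁻¹) / (E⁻¹ + lam x ^ 2)‖ ≤ 8 * M / ‖x‖ ^ 2 := by
      rw [norm_div, div_le_div_iff₀ (by linarith) (by linarith)]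
      have : ‖E - E⁻¹‖ ≤ M := (norm_sub_le _ _).trans (by linarith)
      nlinarith [norm_nonneg (E - E⁻¹)]
    have hz2 : 8 * M / ‖x‖ ^ 2 ≤ 1 / 2 := by
      rw [div_le_div_iff₀ (by linarith) (by norm_num)]
      linarith
    rw [gap_eq, e1]
    refine (Complex.norm_log_one_add_half_le_self (hz.trans hz2)).trans ?_
    calc 3 / 2 * ‖(E - E⁻¹) / (E⁻¹ + lam x ^ 2)‖ ≤ 3 / 2 * (8 * M / ‖x‖ ^ 2) := by gcongr
      _ = 12 * M / ‖x‖ ^ 2 := by ring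
      _ ≤ 100 * M ^ 2 / ‖x‖ ^ 2 := by gcongr <;> nlinarith
  · intro x hx h
    have h1 : ‖x‖ ^ 2 ≤ ‖τ‖ + 2 := by
      rw [← norm_pow, h]
      exact (norm_add_le _ _).trans (by norm_num)
    linarith [big x hx]
  · intro x hx
    have h1 := q_le x hx
    have h2 := norm_sub_le (sideFactor τ x) (sideFactor τ x - 1)
    rw [sub_sub_cancel, norm_one] at h2
    linarith
  · intro e hv hl hr hb
    have hp := hv.back_mul_front
    have hs : e.back + e.front = e.left * e.right := by simp [Edge.front]
    unfold Edge.Vertex at hv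
    rw [edgeFactor]
    generalize e.left = x at *
    generalize e.right = y at *
    generalize e.back = z at *
    generalize e.front = w at *
    have hx4 : 4 ≤ ‖x‖ := by linarith
    have hy4 : 4 ≤ ‖y‖ := by linarith
    have hx0 : x ≠ 0 := by rintro rfl; norm_num at hx4
    have hy0 : y ≠ 0 := by rintro rfl; norm_num at hy4
    have hxy : 16 ≤ ‖x‖ * ‖y‖ := by nlinarith
    have hw : ‖x‖ * ‖y‖ ≤ 2 * ‖w‖ := by
      rw [← norm_mul, ← hs]
      exact (norm_add_le _ _).trans (by linarith)
    have hzw : ‖z‖ * ‖w‖ ≤ ‖x‖ ^ 2 + ‖y‖ ^ 2 + M + 1 := by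
      rw [← norm_mul, hp]
      refine (norm_sub_le _ _).trans ?_
      have h1 := norm_add_le (x ^ 2) (y ^ 2)
      have h2 := norm_add_le τ 2
      rw [norm_pow, norm_pow] at h1
      norm_num at h2
      linarith
    -- The product zw is at most of size |x|² + |y|² + M + 1 while |w| ≥ |xy|/2, so z is small and
    -- stays away from the root near mn, where |mn| ≥ (9/16)|xy|.
    have hz : ‖z‖ ≤ ‖x‖ * ‖y‖ / 4 := by
      have h1 := big x hl
      have h2 := big y hr
      have h3 : ‖z‖ * (‖x‖ * ‖y‖) ≤ 2 * (‖x‖ ^ 2 + ‖y‖ ^ 2 + M + 1) := by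
        nlinarith [norm_nonneg z]
      have h4 : 8 * (‖x‖ ^ 2 + ‖y‖ ^ 2 + M + 1) ≤ ‖x‖ ^ 2 * ‖y‖ ^ 2 := by
        nlinarith [sq_nonneg ‖x‖, sq_nonneg ‖y‖]
      have h5 : (‖z‖ - ‖x‖ * ‖y‖ / 4) * (‖x‖ * ‖y‖) ≤ 0 := by nlinarith
      have := nonpos_of_mul_nonpos_left h5 (by linarith)
      linarith
    have hlx := half_norm_le_lam hx4
    have hly := half_norm_le_lam hy4
    have hm := lam_ne_zero x
    have hn := lam_ne_zero y
    have hdn : ‖x‖ * ‖y‖ / 4 ≤ ‖z - (lam x * lam y + (lam x * lam y)⁻¹)‖ := by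
      have h1 : 9 / 16 * (‖x‖ * ‖y‖) ≤ ‖lam x * lam y‖ := by
        rw [norm_mul]
        nlinarith
      have h2 : ‖(lam x * lam y)⁻¹‖ ≤ 1 := by
        rw [norm_inv]
        exact inv_le_one_of_one_le₀ (by linarith)
      have h3 : lam x * lam y = z - (lam x * lam y)⁻¹ -
        (z - (lam x * lam y + (lam x * lam y)⁻¹)) := by ring
      have h4 := norm_sub_le (z - (lam x * lam y)⁻¹)
        (z - (lam x * lam y + (lam x * lam y)⁻¹))
      rw [← h3] at h4
      have h5 := norm_sub_le z (lam x * lam y)⁻¹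
      linarith
    have hd : z - (lam x * lam y + (lam x * lam y)⁻¹) ≠ 0 := by
      intro h0
      rw [h0, norm_zero] at hdn
      linarith
    have key := edge_identity hm hn (lam_add_inv x) (lam_add_inv y) hx0 hy0 hv hd
    have hqx := norm_inv_lam_sq_add_one_le hx4
    have hqy := norm_inv_lam_sq_add_one_le hy4
    have e1 : 1 + (E - 1) * z / (x * y) - sideFactor τ x * sideFactor τ y =
        (E - 1) * (z / (x * y) - 1 / (lam x ^ 2 + 1) - 1 / (lam y ^ 2 + 1)) -
          (E - 1) ^ 2 * ((1 / (lam x ^ 2 + 1)) * (1 / (lam y ^ 2 + 1))) := by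
      rw [sideFactor, sideFactor, ← hE]; ring
    rw [e1, key]
    set D := z - (lam x * lam y + (lam x * lam y)⁻¹)
    set qx := 1 / (lam x ^ 2 + 1)
    set qy := 1 / (lam y ^ 2 + 1)
    set B := ‖x‖ ^ 2 * ‖y‖ ^ 2 with hB
    have hB0 : 0 < B := by positivity
    have hqq : ‖qx * qy‖ ≤ 4 / B := by
      rw [norm_mul]
      calc ‖qx‖ * ‖qy‖ ≤ 2 / ‖x‖ ^ 2 * (2 / ‖y‖ ^ 2) := by gcongr
        _ = 4 / B := by rw [hB]; field_simp; norm_num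
    have hμ : ‖(τ + 2 - 4) / D / (x * y)‖ ≤ 8 * M / B := by
      have h1 : ‖τ + 2 - 4‖ ≤ 2 * M := by
        have := norm_sub_le τ 2
        norm_num at this
        rw [show τ + 2 - 4 = τ - 2 by ring]
        linarith
      rw [norm_div, norm_div, norm_mul, div_div]
      calc ‖τ + 2 - 4‖ / (‖D‖ * (‖x‖ * ‖y‖))
          ≤ 2 * M / (‖x‖ * ‖y‖ / 4 * (‖x‖ * ‖y‖)) := by gcongr
        _ = 8 * M / B := by rw [hB]; field_simp; norm_num
    have h1 : ‖(τ + 2 - 4) / D / (x * y) - 2 * qx * qy‖ ≤ (8 * M + 8) / B := by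
      refine (norm_sub_le _ _).trans ?_
      have : ‖2 * qx * qy‖ = 2 * ‖qx * qy‖ := by rw [mul_assoc, norm_mul]; norm_num
      rw [this, add_div]
      have : (8 : ℝ) / B = 2 * (4 / B) := by ring
      linarith
    refine (norm_sub_le _ _).trans ?_
    rw [norm_mul, norm_mul, norm_pow]
    calc _ ≤ M * ((8 * M + 8) / B) + M ^ 2 * (4 / B) := by gcongr
      _ = (12 * M ^ 2 + 8 * M) / B := by ring
      _ ≤ 100 * M ^ 2 / B := by gcongr; nlinarith

/-! ### The gap identity beyond an edge -/

/-- The sum of the gaps beyond an edge. -/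
def gapSum (τ : ℂ) (e : Edge) : ℂ := ∑' w, gap τ (e.val w)

/-- The sum of the gaps converges absolutely beyond the edge. -/
def GapSummable (τ : ℂ) (e : Edge) : Prop := Summable fun w => ‖gap τ (e.val w)‖

/-- The gap identity for the part of the tree beyond an edge. -/
def IsGood (τ : ℂ) (e : Edge) : Prop :=
  GapSummable τ e ∧
    Complex.exp (gapSum τ e) * (sideFactor τ e.left * sideFactor τ e.right) = edgeFactor τ e

theorem GapSummable.of_child {τ : ℂ} {e : Edge} (h0 : GapSummable τ (e.child false))
    (h1 : GapSummable τ (e.child true)) : GapSummable τ e :=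
  summable_words h0 h1

theorem gapSum_eq {τ : ℂ} {e : Edge} (h0 : GapSummable τ (e.child false))
    (h1 : GapSummable τ (e.child true)) :
    gapSum τ e = gap τ e.front + (gapSum τ (e.child false) + gapSum τ (e.child true)) :=
  (hasSum_words (f := fun w => gap τ (e.val w)) h0.of_norm.hasSum h1.of_norm.hasSum).tsum_eq

theorem exp_gapSum {τ : ℂ} {e : Edge} (h0 : GapSummable τ (e.child false))
    (h1 : GapSummable τ (e.child true)) :
    Complex.exp (gapSum τ e) = Complex.exp (gap τ e.front) *
      (Complex.exp (gapSum τ (e.child false)) * Complex.exp (gapSum τ (e.child true))) := by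
  rw [gapSum_eq h0 h1, Complex.exp_add, Complex.exp_add]

/-- The front region is a side of both children, so their identities multiply to one containing the
square of its side factor. `sideFactor_sq` trades this square for the gap of the front region and
the extra factor of `edgeFactor_child`. -/
theorem IsGood.of_child {τ : ℂ} {e : Edge} (hv : e.Vertex (τ + 2)) (hl : e.left ≠ 0)
    (hr : e.right ≠ 0) (hf : e.front ≠ 0) (hf2 : e.front ^ 2 ≠ τ + 2)
    (h : ∀ d, IsGood τ (e.child d)) : IsGood τ e := by
  obtain ⟨s0, p0⟩ := h false
  obtain ⟨s1, p1⟩ := h true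
  refine ⟨.of_child s0 s1, ?_⟩
  have hQ := sideFactor_ne_zero hf hf2
  have hQ2 := sideFactor_sq hf hf2
  have hP := edgeFactor_child τ hv hl hr hf
  rw [exp_gapSum s0 s1]
  rw [← p0, ← p1] at hP
  simp only [Edge.child] at hP ⊢
  apply mul_right_cancel₀ (pow_ne_zero 2 hQ)
  have : edgeFactor τ e * sideFactor τ e.front ^ 2 =
      (edgeFactor τ e * (1 - (τ + 2) / e.front ^ 2)) * Complex.exp (gap τ e.front) := by
    rw [hQ2]; ring
  rw [this, hP]; ring

theorem IsGood.mirror {τ : ℂ} {e : Edge} (h : IsGood τ e) : IsGood τ e.mirror := by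
  let σ : List Bool ≃ List Bool :=
    { toFun := List.map not
      invFun := List.map not
      left_inv := fun w => by simp [Function.comp_def]
      right_inv := fun w => by simp [Function.comp_def] }
  have hs : (fun w => gap τ (e.mirror.val w)) = (fun w => gap τ (e.val w)) ∘ σ := by
    funext w; simp only [Edge.val_mirror, Function.comp]; rfl
  refine ⟨?_, ?_⟩
  · have : (fun w => ‖gap τ (e.mirror.val w)‖) = (fun w => ‖gap τ (e.val w)‖) ∘ σ := by
      funext w; simp only [Edge.val_mirror, Function.comp]; rfl
    rw [GapSummable, this, σ.summable_iff]
    exact h.1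
  · have : gapSum τ e.mirror = gapSum τ e := by
      rw [gapSum, hs]
      exact σ.tsum_eq (fun w => gap τ (e.val w))
    have h2 : edgeFactor τ e.mirror = edgeFactor τ e := by
      simp only [edgeFactor, Edge.mirror]; ring
    rw [this, h2, ← h.2]
    simp only [Edge.mirror]; ring

/-- The defect of the gap identity beyond an edge. -/
def ratio (τ : ℂ) (e : Edge) : ℂ :=
  edgeFactor τ e / (Complex.exp (gapSum τ e) * (sideFactor τ e.left * sideFactor τ e.right))

/-- The computation of `IsGood.of_child`, made without assuming the identity for the children: the
defect can be pushed towards infinity. -/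
theorem ratio_eq {τ : ℂ} {e : Edge} (hv : e.Vertex (τ + 2)) (hl : e.left ≠ 0)
    (hr : e.right ≠ 0) (hf : e.front ≠ 0) (hf2 : e.front ^ 2 ≠ τ + 2)
    (hQl : sideFactor τ e.left ≠ 0) (hQr : sideFactor τ e.right ≠ 0)
    (h0 : GapSummable τ (e.child false)) (h1 : GapSummable τ (e.child true)) :
    ratio τ e = ratio τ (e.child false) * ratio τ (e.child true) := by
  have hQ := sideFactor_ne_zero hf hf2
  have hQ2 := sideFactor_sq hf hf2
  have hP := edgeFactor_child τ hv hl hr hf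
  rw [ratio, ratio, ratio, exp_gapSum h0 h1, div_mul_div_comm, ← hP]
  simp only [Edge.child] at hP ⊢
  rw [div_eq_div_iff (by simp [hQl, hQr]) (by simp [hQl, hQr, hQ])]
  linear_combination (edgeFactor τ e * Complex.exp (gapSum τ ⟨e.left, e.front, e.right⟩) *
    Complex.exp (gapSum τ ⟨e.front, e.right, e.left⟩) * sideFactor τ e.left *
      sideFactor τ e.right) * hQ2

theorem isGood_of_ratio {τ : ℂ} {e : Edge} (hs : GapSummable τ e) (hr : ratio τ e = 1)
    (h0 : sideFactor τ e.left ≠ 0) (h1 : sideFactor τ e.right ≠ 0) : IsGood τ e :=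
  ⟨hs, ((div_eq_one_iff_eq (mul_ne_zero (Complex.exp_ne_zero _) (mul_ne_zero h0 h1))).mp hr).symm⟩

/-! ### Edges pointing away from the small traces -/

/-- The edge separates large traces, and points away from the smaller ones. -/
structure Outward (μ : ℂ) (K : ℝ) (e : Edge) : Prop where
  vertex : e.Vertex μ
  left_le : K ≤ ‖e.left‖
  right_le : K ≤ ‖e.right‖
  back_le : ‖e.back‖ ≤ ‖e.front‖

theorem norm_mul_le_two_front {e : Edge} (h : ‖e.back‖ ≤ ‖e.front‖) :
    ‖e.left‖ * ‖e.right‖ ≤ 2 * ‖e.front‖ := by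
  have : e.left * e.right = e.back + e.front := by simp [Edge.front]
  rw [← norm_mul, this]
  exact (norm_add_le _ _).trans (by linarith)

/-- From |x||y| ≤ 2|w| and |x|, |y| ≥ 2 the front value w dominates both sides, and |xw - y| ≥ 2|w|
- |y| ≥ |y|; the other child is symmetric. -/
theorem Outward.child {μ : ℂ} {K : ℝ} {e : Edge} (hK : 2 ≤ K) (h : Outward μ K e) (d : Bool) :
    Outward μ K (e.child d) := by
  have h2 := norm_mul_le_two_front h.back_le
  have hl := h.left_le
  have hr := h.right_le
  cases d
  · refine ⟨h.vertex.child _, hl, ?_, ?_⟩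
    · simp only [Edge.child]; nlinarith
    · have := norm_sub_norm_le (e.left * e.front) e.right
      rw [norm_mul] at this
      simp only [Edge.child, Edge.front] at *
      nlinarith [norm_nonneg (e.left * e.right - e.back)]
  · refine ⟨h.vertex.child _, ?_, hr, ?_⟩
    · simp only [Edge.child]; nlinarith
    · have := norm_sub_norm_le (e.front * e.right) e.left
      rw [norm_mul] at this
      simp only [Edge.child, Edge.front] at *
      nlinarith [norm_nonneg (e.left * e.right - e.back)]

/-- The size of the gap identity beyond an edge. -/
def weight (e : Edge) : ℝ := 1 / (‖e.left‖ ^ 2 * ‖e.right‖ ^ 2)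

theorem weight_nonneg (e : Edge) : 0 ≤ weight e := by unfold weight; positivity

/-- A side y is replaced by w with |w| ≥ |x||y|/2 ≥ 2|y|, so each child loses a factor 4 and the two
together a factor 2. -/
theorem Outward.weight_child_le {μ : ℂ} {K : ℝ} {e : Edge} (hK : 4 ≤ K) (h : Outward μ K e)
    (d : Bool) : weight (e.child d) ≤ weight e / 4 := by
  have h2 := norm_mul_le_two_front h.back_le
  have hl := h.left_le
  have hr := h.right_le
  have hl0 : 0 < ‖e.left‖ := by linarith
  have hr0 : 0 < ‖e.right‖ := by linarith
  have e1 : weight e / 4 = 1 / (4 * (‖e.left‖ ^ 2 * ‖e.right‖ ^ 2)) := by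
    rw [weight]; field_simp
  rw [e1, weight]
  have h3 : (‖e.left‖ * ‖e.right‖) ^ 2 ≤ 4 * ‖e.front‖ ^ 2 := by
    have := pow_le_pow_left₀ (by positivity) h2 2
    linarith [mul_pow 2 ‖e.front‖ 2]
  apply one_div_le_one_div_of_le (by positivity)
  cases d
  · simp only [Edge.child]
    have : 16 ≤ ‖e.left‖ ^ 2 := by nlinarith
    nlinarith [sq_nonneg ‖e.front‖]
  · simp only [Edge.child]
    have : 16 ≤ ‖e.right‖ ^ 2 := by nlinarith
    nlinarith [sq_nonneg ‖e.front‖]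

/-- The front gap costs at most 4C times the weight, and the children carry at most half the weight
together, so the constant 8C reproduces itself. -/
theorem Outward.sum_le {τ : ℂ} {K C : ℝ} (L : Large τ K C) {e : Edge}
    (h : Outward (τ + 2) K e) (n : ℕ) :
    ∑ w ∈ shortWords n, ‖gap τ (e.val w)‖ ≤ 8 * C * weight e := by
  have hK := L.four_le
  have hC := L.nonneg
  induction n generalizing e with
  | zero => simpa [shortWords] using mul_nonneg (by linarith) (weight_nonneg e)
  | succ n ih =>
    rw [sum_shortWords_succ]
    have i0 := ih (h.child (by linarith) false)
    have i1 := ih (h.child (by linarith) true)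
    have w0 := h.weight_child_le hK false
    have w1 := h.weight_child_le hK true
    have h2 := norm_mul_le_two_front h.back_le
    have hl := h.left_le
    have hr := h.right_le
    have hl0 : 0 < ‖e.left‖ := by linarith
    have hr0 : 0 < ‖e.right‖ := by linarith
    have hg := L.gap_le e.front (by nlinarith)
    have hg2 : C / ‖e.front‖ ^ 2 ≤ 4 * C * weight e := by
      have : 4 * C * weight e = C / ((‖e.left‖ * ‖e.right‖ / 2) ^ 2) := by
        rw [weight]; field_simp
        ring
      rw [this]
      gcongr
      linarith
    simp only [Edge.val_cons, Edge.val_nil]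
    nlinarith

theorem Outward.gapSummable {τ : ℂ} {K C : ℝ} (L : Large τ K C) {e : Edge}
    (h : Outward (τ + 2) K e) : GapSummable τ e ∧ ‖gapSum τ e‖ ≤ 8 * C * weight e := by
  obtain ⟨h1, h2⟩ := hasSum_le_of_shortWords (fun w => norm_nonneg (gap τ (e.val w)))
    (h.sum_le L)
  exact ⟨h1, (norm_tsum_le_tsum_norm h1).trans h2⟩

theorem norm_exp_sub_one_le_exp (z : ℂ) : ‖Complex.exp z - 1‖ ≤ Real.exp ‖z‖ - 1 := by
  have := Complex.norm_exp_sub_sum_le_exp_norm_sub_sum z 1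
  simpa using this

/-- Bounds of the form exp s - 1 are used because under products the exponents simply add. -/
theorem norm_mul_sub_one_le {a b : ℂ} {s t : ℝ} (ha : ‖a - 1‖ ≤ Real.exp s - 1)
    (hb : ‖b - 1‖ ≤ Real.exp t - 1) : ‖a * b - 1‖ ≤ Real.exp (s + t) - 1 := by
  have : a * b - 1 = (a - 1) * (b - 1) + (a - 1) + (b - 1) := by ring
  rw [this, Real.exp_add]
  have h1 := norm_add₃_le (a := (a - 1) * (b - 1)) (b := a - 1) (c := b - 1)
  rw [norm_mul] at h1
  nlinarith [mul_le_mul ha hb (norm_nonneg _) ((norm_nonneg _).trans ha)]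

theorem Large.ne_zero {τ : ℂ} {K C : ℝ} (L : Large τ K C) {x : ℂ} (hx : K ≤ ‖x‖) : x ≠ 0 := by
  rintro rfl
  rw [norm_zero] at hx
  linarith [L.four_le]

theorem Large.sideFactor_ne_zero {τ : ℂ} {K C : ℝ} (L : Large τ K C) {x : ℂ} (hx : K ≤ ‖x‖) :
    sideFactor τ x ≠ 0 := by
  intro h
  have := L.half_le x hx
  rw [h, norm_zero] at this
  norm_num at this

/-- Here 12 = 4 + 8: the edge estimate divided by |Q| ≥ 1/4, and the bound for the sum of the gaps.
-/
theorem Outward.ratio_le {τ : ℂ} {K C : ℝ} (L : Large τ K C) {e : Edge}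
    (h : Outward (τ + 2) K e) : ‖ratio τ e - 1‖ ≤ Real.exp (12 * C * weight e) - 1 := by
  have hC := L.nonneg
  have hw := weight_nonneg e
  have q0 := L.sideFactor_ne_zero h.left_le
  have q1 := L.sideFactor_ne_zero h.right_le
  set Q := sideFactor τ e.left * sideFactor τ e.right with hQ
  have hQ0 : Q ≠ 0 := mul_ne_zero q0 q1
  have hQ4 : 1 / 4 ≤ ‖Q‖ := by
    rw [hQ, norm_mul]
    nlinarith [L.half_le _ h.left_le, L.half_le _ h.right_le]
  have h1 : ‖edgeFactor τ e / Q - 1‖ ≤ Real.exp (4 * C * weight e) - 1 := by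
    have : edgeFactor τ e / Q - 1 = (edgeFactor τ e - Q) / Q := by field_simp
    rw [this, norm_div]
    have h2 := L.edge_le e h.vertex h.left_le h.right_le h.back_le
    have h3 : C / (‖e.left‖ ^ 2 * ‖e.right‖ ^ 2) = C * weight e := by rw [weight]; ring
    rw [h3] at h2
    calc ‖edgeFactor τ e - Q‖ / ‖Q‖ ≤ C * weight e / (1 / 4) := by gcongr
      _ = 4 * C * weight e := by ring
      _ ≤ _ := by linarith [Real.add_one_le_exp (4 * C * weight e)]
  have h2 : ‖Complex.exp (-gapSum τ e) - 1‖ ≤ Real.exp (8 * C * weight e) - 1 := by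
    refine (norm_exp_sub_one_le_exp _).trans ?_
    rw [norm_neg]
    have := (h.gapSummable L).2
    gcongr
  have : ratio τ e = edgeFactor τ e / Q * Complex.exp (-gapSum τ e) := by
    rw [ratio, Complex.exp_neg, ← hQ]
    field_simp
  rw [this]
  refine (norm_mul_sub_one_le h1 h2).trans (le_of_eq ?_)
  ring_nf

/-- Expanded n levels deep, the defect is a product over edges whose total weight is at most 2⁻ⁿ
times the initial one; letting n grow forces it to be 1. -/
theorem Outward.ratio_eq_one {τ : ℂ} {K C : ℝ} (L : Large τ K C) {e : Edge}
    (h : Outward (τ + 2) K e) : ratio τ e = 1 := by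
  have hK := L.four_le
  have hC := L.nonneg
  have key : ∀ n : ℕ, ∀ e : Edge, Outward (τ + 2) K e →
      ‖ratio τ e - 1‖ ≤ Real.exp (12 * C * weight e * (1 / 2) ^ n) - 1 := by
    intro n
    induction n with
    | zero => intro e he; simpa using he.ratio_le L
    | succ n ih =>
      intro e he
      have c0 := he.child (by linarith) false
      have c1 := he.child (by linarith) true
      have hf : K ≤ ‖e.front‖ := c0.right_le
      rw [ratio_eq he.vertex (L.ne_zero he.left_le) (L.ne_zero he.right_le) (L.ne_zero hf)
        (L.sq_ne _ hf) (L.sideFactor_ne_zero he.left_le) (L.sideFactor_ne_zero he.right_le) (c0.gapSummable L).1 (c1.gapSummable L).1]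
      refine (norm_mul_sub_one_le (ih _ c0) (ih _ c1)).trans ?_
      have w0 := he.weight_child_le hK false
      have w1 := he.weight_child_le hK true
      gcongr
      have : weight (e.child false) + weight (e.child true) ≤ weight e * (1 / 2) := by linarith
      calc _ = 12 * C * (weight (e.child false) + weight (e.child true)) * (1 / 2) ^ n := by ring
        _ ≤ 12 * C * (weight e * (1 / 2)) * (1 / 2) ^ n := by gcongr
        _ = _ := by ring
  have lim : Tendsto (fun n : ℕ => Real.exp (12 * C * weight e * (1 / 2) ^ n) - 1) atTop
      (𝓝 0) := by
    have h1 := (tendsto_pow_atTop_nhds_zero_of_lt_one (r := (1 / 2 : ℝ)) (by norm_num)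
      (by norm_num)).const_mul (12 * C * weight e)
    rw [mul_zero] at h1
    have := ((Real.continuous_exp.tendsto 0).comp h1).sub_const 1
    simpa using this
  have := ge_of_tendsto' lim fun n => key n e h
  exact sub_eq_zero.mp (norm_le_zero_iff.mp this)

theorem Outward.isGood {τ : ℂ} {K C : ℝ} (L : Large τ K C) {e : Edge}
    (h : Outward (τ + 2) K e) : IsGood τ e :=
  isGood_of_ratio (h.gapSummable L).1 (h.ratio_eq_one L) (L.sideFactor_ne_zero h.left_le)
    (L.sideFactor_ne_zero h.right_le)

end

end PuncturedTorus

/-! ### The BQ-conditions and the boundary of a single region. -/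

namespace PuncturedTorus

open Filter Topology

noncomputable section

/-! ### Edges satisfying the BQ-conditions -/

namespace Edge

/-- Only finitely many values beyond the edge have modulus at most two. -/
def SmallFinite (e : Edge) : Prop := {w | ‖e.val w‖ ≤ 2}.Finite

theorem SmallFinite.child {e : Edge} (h : e.SmallFinite) (d : Bool) :
    (e.child d).SmallFinite :=
  h.preimage (f := List.cons d) List.cons_injective.injOn

theorem SmallFinite.mirror {e : Edge} (h : e.SmallFinite) : e.mirror.SmallFinite := by
  have hinj : Function.Injective (List.map not) :=
    Function.LeftInverse.injective (g := List.map not) fun w => by simp [Function.comp_def]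
  have := h.preimage (f := List.map not) hinj.injOn
  unfold SmallFinite
  simp only [val_mirror]
  exact this

/-- The edges met when one follows the boundary of the left region. -/
def fan (e : Edge) (n : ℕ) : Edge := (child false)^[n] e

theorem fan_succ (e : Edge) (n : ℕ) : e.fan (n + 1) = (e.fan n).child false :=
  Function.iterate_succ_apply' _ _ _

@[simp] theorem fan_left (e : Edge) (n : ℕ) : (e.fan n).left = e.left := by
  induction n with
  | zero => rfl
  | succ n ih => rw [fan_succ, ← ih]; rfl

theorem fan_right_succ (e : Edge) (n : ℕ) : (e.fan (n + 1)).right = (e.fan n).front := by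
  rw [fan_succ]; rfl

theorem fan_back_succ (e : Edge) (n : ℕ) : (e.fan (n + 1)).back = (e.fan n).right := by
  rw [fan_succ]; rfl

theorem val_replicate (e : Edge) (n : ℕ) :
    e.val (List.replicate n false) = (e.fan n).front := by
  induction n generalizing e with
  | zero => rfl
  | succ n ih => rw [List.replicate_succ, val_cons, ih]; rfl

/-- Around a region with value x the consecutive values satisfy a linear recurrence with eigenvalues
λ and λ⁻¹. This is its eigencoordinate for λ, and `fan_contracting` the one for λ⁻¹. -/
theorem fan_expanding (e : Edge) (n : ℕ) :
    (e.fan n).right - (lam e.left)⁻¹ * (e.fan n).back =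
      lam e.left ^ n * (e.right - (lam e.left)⁻¹ * e.back) := by
  induction n with
  | zero => simp [fan]
  | succ n ih =>
    rw [pow_succ', mul_assoc, ← ih, fan_right_succ, fan_back_succ, front, fan_left]
    have h1 := lam_add_inv e.left
    have h2 := mul_inv_cancel₀ (lam_ne_zero e.left)
    generalize (lam e.left)⁻¹ = i at *
    linear_combination (-(e.fan n).right) * h1 + (e.fan n).back * h2

theorem fan_contracting (e : Edge) (n : ℕ) :
    (e.fan n).right - lam e.left * (e.fan n).back =
      (lam e.left)⁻¹ ^ n * (e.right - lam e.left * e.back) := by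
  induction n with
  | zero => simp [fan]
  | succ n ih =>
    rw [pow_succ', mul_assoc, ← ih, fan_right_succ, fan_back_succ, front, fan_left]
    have h1 := lam_add_inv e.left
    have h2 := mul_inv_cancel₀ (lam_ne_zero e.left)
    generalize (lam e.left)⁻¹ = i at *
    linear_combination (-(e.fan n).right) * h1 + (e.fan n).back * h2

end Edge

theorem lam_sub_inv_ne_zero {x : ℂ} (hx : x ∉ realSegment) : lam x - (lam x)⁻¹ ≠ 0 := by
  intro h
  have h1 := one_lt_norm_lam hx
  have h2 := norm_lam_inv_le x
  rw [← sub_eq_zero.mp h] at h2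
  linarith

theorem norm_lam_inv_lt {x : ℂ} (hx : x ∉ realSegment) : ‖(lam x)⁻¹‖ < 1 := by
  rw [norm_inv]
  exact inv_lt_one_of_one_lt₀ (one_lt_norm_lam hx)

namespace Edge

/-- Without an expanding component the values around the region would tend to zero, so infinitely
many would have modulus at most 2. -/
theorem SmallFinite.expanding_ne_zero {e : Edge} (h : e.SmallFinite)
    (hl : e.left ∉ realSegment) : e.right - (lam e.left)⁻¹ * e.back ≠ 0 := by
  intro h0
  have hd := lam_sub_inv_ne_zero hl
  have hr : ∀ n, (e.fan n).right = (lam e.left)⁻¹ ^ n *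
      (-(lam e.left)⁻¹ * (e.right - lam e.left * e.back) / (lam e.left - (lam e.left)⁻¹)) := by
    intro n
    have h1 := e.fan_expanding n
    have h2 := e.fan_contracting n
    rw [h0, mul_zero] at h1
    rw [mul_div_assoc', eq_div_iff hd, mul_left_comm, ← h2]
    linear_combination lam e.left * h1 - (e.fan n).back * mul_inv_cancel₀ (lam_ne_zero e.left) +
      (e.fan n).back * inv_mul_cancel₀ (lam_ne_zero e.left)
  -- The index is shifted because the word of n letters `false` gives the front of `fan n`, the
  -- right side of `fan (n + 1)`.
  have lim : Tendsto (fun n => ‖(e.fan (n + 1)).right‖) atTop (𝓝 0) := by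
    have := ((tendsto_pow_atTop_nhds_zero_of_norm_lt_one (norm_lam_inv_lt hl)).mul_const
      (-(lam e.left)⁻¹ * (e.right - lam e.left * e.back) / (lam e.left - (lam e.left)⁻¹))).norm
    simp only [zero_mul, norm_zero, ← hr] at this
    exact this.comp (tendsto_add_atTop_nat 1)
  obtain ⟨N, hN⟩ := eventually_atTop.mp (lim.eventually (ge_mem_nhds (by norm_num : (0:ℝ) < 2)))
  have hinj : Function.Injective fun n : ℕ => List.replicate n false := fun a b hab => by
    simpa using congrArg List.length hab
  have hfin := h.preimage (f := fun n : ℕ => List.replicate n false) hinj.injOn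
  refine (Set.infinite_of_injective_forall_mem (f := fun n : ℕ => N + n)
    (fun a b hab => by simpa using hab) fun n => ?_) hfin
  simp only [Set.mem_preimage, Set.mem_ofPred_eq, val_replicate, ← fan_right_succ]
  exact hN _ (by omega)

/-- The expanding components y - z/λ and z - y/λ in the two directions around the region are
nonzero, and by the vertex relation their product is (x² - μ)/λ. -/
theorem left_sq_ne {μ : ℂ} {e : Edge} (hv : e.Vertex μ) (hl : e.left ∉ realSegment)
    (h1 : e.SmallFinite) (h2 : SmallFinite ⟨e.left, e.back, e.right⟩) : e.left ^ 2 ≠ μ := by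
  intro h
  have a1 := h1.expanding_ne_zero hl
  have a2 := h2.expanding_ne_zero hl
  simp only at a2
  have h3 := lam_add_inv e.left
  have h4 := mul_inv_cancel₀ (lam_ne_zero e.left)
  unfold Vertex at hv
  refine mul_ne_zero (mul_ne_zero a1 a2) (lam_ne_zero e.left) ?_
  generalize (lam e.left)⁻¹ = i at *
  linear_combination -hv + h + e.right * e.back * h3 +
    (i * e.right * e.back - e.right ^ 2 - e.back ^ 2) * h4

/-- The BQ-conditions around and beyond an edge. -/
structure Regular (μ : ℂ) (e : Edge) : Prop where
  vertex : e.Vertex μ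
  left_notMem : e.left ∉ realSegment
  right_notMem : e.right ∉ realSegment
  val_notMem : ∀ w, e.val w ∉ realSegment
  smallFinite : e.SmallFinite

theorem Regular.child {μ : ℂ} {e : Edge} (h : e.Regular μ) (d : Bool) :
    (e.child d).Regular μ := by
  have hf := h.val_notMem []
  refine ⟨h.vertex.child d, ?_, ?_, fun w => h.val_notMem (d :: w), h.smallFinite.child d⟩
  · cases d
    · exact h.left_notMem
    · exact hf
  · cases d
    · exact hf
    · exact h.right_notMem

theorem Regular.mirror {μ : ℂ} {e : Edge} (h : e.Regular μ) : e.mirror.Regular μ :=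
  ⟨h.vertex.mirror, h.right_notMem, h.left_notMem, fun w => by
    rw [val_mirror]; exact h.val_notMem _, h.smallFinite.mirror⟩

/-- The front region is a side of both children; one child and the mirror image of the other follow
its boundary in opposite directions. -/
theorem Regular.val_sq_ne {μ : ℂ} {e : Edge} (h : e.Regular μ) (w : List Bool) :
    e.val w ^ 2 ≠ μ := by
  induction w generalizing e with
  | nil =>
    exact left_sq_ne (h.child true).vertex (h.child true).left_notMem
      (h.child true).smallFinite (h.child false).mirror.smallFinite
  | cons d w ih => exact ih (h.child d)

/-- The BQ-conditions around and beyond an edge, and their consequence on squares. -/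
structure Admissible (μ : ℂ) (e : Edge) : Prop extends Regular μ e where
  left_sq : e.left ^ 2 ≠ μ
  right_sq : e.right ^ 2 ≠ μ

theorem Admissible.child {μ : ℂ} {e : Edge} (h : e.Admissible μ) (d : Bool) :
    (e.child d).Admissible μ := by
  have hf := h.val_sq_ne []
  refine ⟨h.toRegular.child d, ?_, ?_⟩
  · cases d
    · exact h.left_sq
    · exact hf
  · cases d
    · exact hf
    · exact h.right_sq

theorem Admissible.mirror {μ : ℂ} {e : Edge} (h : e.Admissible μ) : e.mirror.Admissible μ :=
  ⟨h.toRegular.mirror, h.right_sq, h.left_sq⟩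

theorem Admissible.fan {μ : ℂ} {e : Edge} (h : e.Admissible μ) (n : ℕ) :
    (e.fan n).Admissible μ := by
  induction n with
  | zero => exact h
  | succ n ih => rw [fan_succ]; exact ih.child false

end Edge

theorem IsGood.of_children {τ : ℂ} {e : Edge} (h : e.Admissible (τ + 2))
    (hc : ∀ d, IsGood τ (e.child d)) : IsGood τ e :=
  .of_child h.vertex (ne_zero_of_notMem h.left_notMem) (ne_zero_of_notMem h.right_notMem)
    (ne_zero_of_notMem (h.val_notMem [])) (h.val_sq_ne []) hc

/-! ### Following the boundary of a region -/

theorem tendsto_sideFactor (τ : ℂ) {ι : Type*} {l : Filter ι} {f : ι → ℂ}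
    (hf : Tendsto (fun i => ‖f i‖) l atTop) : Tendsto (fun i => sideFactor τ (f i)) l (𝓝 1) := by
  have h1 : Tendsto (fun i => 1 / (lam (f i) ^ 2 + 1)) l (𝓝 0) := by
    have h2 : Tendsto (fun i => 2 / ‖f i‖ ^ 2) l (𝓝 0) :=
      ((tendsto_pow_atTop two_ne_zero).comp hf).const_div_atTop 2
    refine squeeze_zero_norm' ?_ h2
    filter_upwards [hf.eventually_ge_atTop 4] with i hi
    exact norm_inv_lam_sq_add_one_le hi
  have h3 := (h1.const_mul (expNu τ - 1)).const_add 1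
  simp only [mul_zero, add_zero, mul_one_div] at h3
  exact h3

theorem Edge.Admissible.exists_fan_growth {μ : ℂ} {e : Edge} (h : e.Admissible μ) :
    (∃ c > 0, ∀ᶠ n in atTop, c * ‖lam e.left‖ ^ n ≤ ‖(e.fan n).right‖) ∧
      Tendsto (fun n => (e.fan n).back / (e.fan n).right) atTop (𝓝 (lam e.left)⁻¹) := by
  have hA := h.smallFinite.expanding_ne_zero h.left_notMem
  have hd := lam_sub_inv_ne_zero h.left_notMem
  have hl := one_lt_norm_lam h.left_notMem
  have hl0 := lam_ne_zero e.left
  set L := lam e.left with hL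
  have lim0 : Tendsto (fun n : ℕ => L⁻¹ ^ n * L⁻¹ ^ n * (e.right - L * e.back)) atTop (𝓝 0) := by
    have := tendsto_pow_atTop_nhds_zero_of_norm_lt_one (norm_lam_inv_lt h.left_notMem)
    simpa using (this.mul this).mul_const (e.right - L * e.back)
  -- The amplitude of the expanding mode: the back values are asymptotic to ALⁿ and the right values
  -- to ALⁿ⁺¹.
  set A := (e.right - L⁻¹ * e.back) / (L - L⁻¹) with hAdef
  have hA0 : A ≠ 0 := div_ne_zero hA hd
  have er : ∀ n, L⁻¹ ^ n * (e.fan n).right =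
      L * A - L⁻¹ * (L⁻¹ ^ n * L⁻¹ ^ n * (e.right - L * e.back)) / (L - L⁻¹) := by
    intro n
    have h1 := e.fan_expanding n
    have h2 := e.fan_contracting n
    rw [← hL] at h1 h2
    have hp : L⁻¹ ^ n * L ^ n = 1 := by rw [← mul_pow, inv_mul_cancel₀ hl0, one_pow]
    rw [hAdef, mul_div_assoc', ← sub_div, eq_div_iff hd]
    linear_combination L⁻¹ ^ n * L * h1 - L⁻¹ ^ n * L⁻¹ * h2 +
      L * (e.right - L⁻¹ * e.back) * hp
  have eb : ∀ n, L⁻¹ ^ n * (e.fan n).back =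
      A - (L⁻¹ ^ n * L⁻¹ ^ n * (e.right - L * e.back)) / (L - L⁻¹) := by
    intro n
    have h1 := e.fan_expanding n
    have h2 := e.fan_contracting n
    rw [← hL] at h1 h2
    have hp : L⁻¹ ^ n * L ^ n = 1 := by rw [← mul_pow, inv_mul_cancel₀ hl0, one_pow]
    rw [hAdef, ← sub_div, eq_div_iff hd]
    linear_combination L⁻¹ ^ n * h1 - L⁻¹ ^ n * h2 + (e.right - L⁻¹ * e.back) * hp
  have limr : Tendsto (fun n => L⁻¹ ^ n * (e.fan n).right) atTop (𝓝 (L * A)) := by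
    simp only [er]
    simpa using (lim0.const_mul L⁻¹).div_const (L - L⁻¹) |>.const_sub (L * A)
  have limb : Tendsto (fun n => L⁻¹ ^ n * (e.fan n).back) atTop (𝓝 A) := by
    simp only [eb]
    simpa using lim0.div_const (L - L⁻¹) |>.const_sub A
  have hLA : L * A ≠ 0 := mul_ne_zero hl0 hA0
  refine ⟨⟨‖L * A‖ / 2, by positivity, ?_⟩, ?_⟩
  · have hpos : ‖L * A‖ / 2 < ‖L * A‖ := by
      have := norm_pos_iff.mpr hLA
      linarith
    filter_upwards [limr.norm.eventually (lt_mem_nhds hpos)] with n hn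
    rw [norm_mul (L⁻¹ ^ n), norm_pow, norm_inv, inv_pow, inv_mul_eq_div,
      lt_div_iff₀ (by positivity)] at hn
    exact hn.le
  · have := limb.div limr hLA
    have e1 : A / (L * A) = L⁻¹ := by field_simp
    rw [e1] at this
    refine this.congr fun n => ?_
    simp only [Pi.div_apply]
    rw [mul_div_mul_left _ _ (pow_ne_zero n (inv_ne_zero hl0))]

/-- The left value x may be small, so the estimates for large edges do not apply to the fan itself.
The edges leaving it are eventually outward with ratio 1, hence the ratio is constant far along the
fan. It tends to 1: back/right tends to λ⁻¹, so the edge factor tends to 1 + (E - 1)/(xλ) = Q(x),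
while the gap sum tends to 0 and the right side factor to 1. -/
theorem Edge.Admissible.exists_fan_isGood {τ : ℂ} {e : Edge} (h : e.Admissible (τ + 2)) :
    ∃ n, IsGood τ (e.fan n) := by
  obtain ⟨K, C, L⟩ := exists_large τ
  have hK := L.four_le
  have hC := L.nonneg
  obtain ⟨⟨c, hc, hgrow⟩, hquot⟩ := h.exists_fan_growth
  have hρ := one_lt_norm_lam h.left_notMem
  set ρ := ‖lam e.left‖ with hρdef
  have hinf : Tendsto (fun n => ‖(e.fan n).right‖) atTop atTop :=
    tendsto_atTop_mono' _ hgrow ((tendsto_pow_atTop_atTop_of_one_lt hρ).const_mul_atTop hc)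
  obtain ⟨N, hN⟩ := eventually_atTop.mp
    (hgrow.and ((hinf.eventually_ge_atTop K).and (hinf.eventually_ge_atTop (2 * ‖e.left‖))))
  have hrK : ∀ n ≥ N, K ≤ ‖(e.fan n).right‖ := fun n hn => (hN n hn).2.1
  have hfK : ∀ n ≥ N, K ≤ ‖(e.fan n).front‖ := fun n hn => by
    rw [← fan_right_succ]; exact hrK _ (by omega)
  set σ := (ρ ^ 2)⁻¹ with hσ
  have hσ0 : 0 < σ := by positivity
  have hσ1 : σ < 1 := inv_lt_one_of_one_lt₀ (one_lt_pow₀ hρ two_ne_zero)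
  have hinv : ∀ n ≥ N, 1 / ‖(e.fan n).right‖ ^ 2 ≤ σ ^ n / c ^ 2 := by
    intro n hn
    have e1 : σ ^ n / c ^ 2 = 1 / (c * ρ ^ n) ^ 2 := by
      rw [hσ, inv_pow, mul_pow, ← pow_mul, ← pow_mul, mul_comm 2 n]; field_simp
    rw [e1]
    have := (hN n hn).1
    gcongr
  have hout : ∀ n ≥ N, Outward (τ + 2) K ((e.fan n).child true) := by
    intro n hn
    have h1 := hfK n hn
    have h2 := hrK n hn
    refine ⟨((h.fan n).vertex.child true), h1, h2, ?_⟩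
    have h3 := norm_sub_norm_le ((e.fan n).front * (e.fan n).right) e.left
    rw [norm_mul] at h3
    have h4 := (hN n hn).2.2
    have h5 : ((e.fan n).child true).front = (e.fan n).front * (e.fan n).right - e.left := by
      simp only [Edge.child, Edge.front, fan_left]
    have h6 : ((e.fan n).child true).back = e.left := by simp [Edge.child]
    rw [h5, h6]
    nlinarith [norm_nonneg (e.fan n).right]
  -- At step n the front gap costs at most Cσⁿ/c² and the branch leaving the fan 8Cσⁿ/c². M solves
  -- 9C/c² + Mσ = M, so that the bound Mσⁿ reproduces itself.
  set M := 9 * C / c ^ 2 / (1 - σ) with hM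
  have hM0 : 0 ≤ M := by
    have : 0 < 1 - σ := by linarith
    positivity
  have hMeq : 9 * C / c ^ 2 + M * σ = M := by
    have : 1 - σ ≠ 0 := by linarith
    rw [hM]; field_simp; ring
  have hsum : ∀ k, ∀ n ≥ N, ∑ w ∈ shortWords k, ‖gap τ ((e.fan n).val w)‖ ≤ M * σ ^ n := by
    intro k
    induction k with
    | zero => intro n _; simp only [shortWords, Finset.sum_empty]; positivity
    | succ k ih =>
      intro n hn
      rw [sum_shortWords_succ]
      simp only [val_cons, val_nil]
      have i0 := ih (n + 1) (by omega)
      rw [fan_succ] at i0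
      have i1 := (hout n hn).sum_le L k
      have i2 := L.gap_le _ (hfK n hn)
      have hn1 := hinv n hn
      have hn2 := hinv (n + 1) (by omega)
      rw [fan_right_succ] at hn2
      have hσn : σ ^ (n + 1) ≤ σ ^ n := pow_le_pow_of_le_one hσ0.le hσ1.le (by omega)
      have hw : weight ((e.fan n).child true) ≤ σ ^ n / c ^ 2 := by
        refine le_trans ?_ hn1
        rw [weight]
        simp only [Edge.child]
        have h1 := hfK n hn
        have h2 := hrK n hn
        have : 1 ≤ ‖(e.fan n).front‖ ^ 2 := by nlinarith
        have h3 : 0 < ‖(e.fan n).right‖ ^ 2 := by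
          have : 0 < ‖(e.fan n).right‖ := by linarith
          positivity
        apply one_div_le_one_div_of_le h3
        nlinarith
      have i3 : C / ‖(e.fan n).front‖ ^ 2 ≤ C * (σ ^ n / c ^ 2) := by
        rw [div_eq_mul_one_div]
        exact mul_le_mul_of_nonneg_left
          (hn2.trans (div_le_div_of_nonneg_right hσn (by positivity))) hC
      have i4 : 8 * C * weight ((e.fan n).child true) ≤ 8 * C * (σ ^ n / c ^ 2) := by gcongr
      have e2 : M * σ ^ n = 9 * (C * (σ ^ n / c ^ 2)) + M * σ ^ (n + 1) := by
        conv_lhs => rw [← hMeq]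
        rw [pow_succ]; ring
      linarith
  have hS : ∀ n ≥ N, GapSummable τ (e.fan n) ∧ ‖gapSum τ (e.fan n)‖ ≤ M * σ ^ n := by
    intro n hn
    obtain ⟨h1, h2⟩ := hasSum_le_of_shortWords (fun w => norm_nonneg (gap τ ((e.fan n).val w)))
      fun k => hsum k n hn
    exact ⟨h1, (norm_tsum_le_tsum_norm h1).trans h2⟩
  have hl0 := ne_zero_of_notMem h.left_notMem
  have hQl := sideFactor_ne_zero hl0 h.left_sq
  have hconst : ∀ k, ratio τ (e.fan (N + k)) = ratio τ (e.fan N) := by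
    intro k
    induction k with
    | zero => rfl
    | succ k ih =>
      have hn : N + k ≥ N := by omega
      have h1 := hS (N + k + 1) (by omega)
      rw [fan_succ] at h1
      rw [← ih, ← add_assoc, fan_succ, ratio_eq (h.fan _).vertex (by rwa [fan_left])
        (L.ne_zero (hrK _ hn)) (L.ne_zero (hfK _ hn)) (L.sq_ne _ (hfK _ hn)) (by rwa [fan_left])
        (L.sideFactor_ne_zero (hrK _ hn)) h1.1 ((hout _ hn).gapSummable L).1,
        (hout _ hn).ratio_eq_one L, mul_one]
  have hlim : Tendsto (fun n => ratio τ (e.fan n)) atTop (𝓝 1) := by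
    have t1 : Tendsto (fun n => edgeFactor τ (e.fan n)) atTop (𝓝 (sideFactor τ e.left)) := by
      have := ((hquot.const_mul ((expNu τ - 1) / e.left)).const_add 1)
      have e1 : 1 + (expNu τ - 1) / e.left * (lam e.left)⁻¹ = sideFactor τ e.left := by
        rw [sideFactor, lam_sq_add_one]
        have := lam_ne_zero e.left
        field_simp
      rw [e1] at this
      refine this.congr fun n => ?_
      rw [edgeFactor, fan_left, div_mul_div_comm]
    have t2 : Tendsto (fun n => Complex.exp (gapSum τ (e.fan n))) atTop (𝓝 1) := by
      have : Tendsto (fun n => gapSum τ (e.fan n)) atTop (𝓝 0) := by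
        have h1 := (tendsto_pow_atTop_nhds_zero_of_lt_one hσ0.le hσ1).const_mul M
        rw [mul_zero] at h1
        refine squeeze_zero_norm' ?_ h1
        filter_upwards [eventually_ge_atTop N] with n hn
        exact (hS n hn).2
      have := (Complex.continuous_exp.tendsto 0).comp this
      rwa [Complex.exp_zero] at this
    have t3 := tendsto_sideFactor τ hinf
    have := t1.div (t2.mul (t3.const_mul (sideFactor τ e.left))) (by simpa using hQl)
    rw [mul_one, one_mul, div_self hQl] at this
    refine this.congr fun n => ?_
    simp only [Pi.div_apply, ratio, fan_left]
  have hone : ratio τ (e.fan N) = 1 := by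
    refine tendsto_nhds_unique ?_ (hlim.comp (tendsto_add_atTop_nat N))
    refine tendsto_const_nhds.congr fun k => ?_
    rw [Function.comp, add_comm, hconst]
  exact ⟨N, isGood_of_ratio (hS N le_rfl).1 hone (by rwa [fan_left])
    (L.sideFactor_ne_zero (hrK N le_rfl))⟩

end

end PuncturedTorus

/-! ### Infinite paths and the identity on the whole tree. -/

namespace PuncturedTorus

open Filter Topology

noncomputable section

/-! ### Infinite paths in the tree -/

namespace Edge

/-- The edge reached along a word. -/
def descend (e : Edge) (w : List Bool) : Edge := w.foldl (fun e d => e.child d) e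

theorem val_append (e : Edge) (v w : List Bool) : e.val (v ++ w) = (e.descend v).val w := by
  induction v generalizing e with
  | nil => rfl
  | cons d v ih => exact ih (e.child d)

theorem val_eq_front (e : Edge) (v : List Bool) : e.val v = (e.descend v).front := by
  have := e.val_append v []
  rwa [List.append_nil] at this

end Edge

/-- `p` is an infinite directed path in the tree, with turns `d`. -/
def IsPath (p : ℕ → Edge) (d : ℕ → Bool) : Prop := ∀ n, p (n + 1) = (p n).child (d n)

namespace IsPath

variable {p : ℕ → Edge} {d : ℕ → Bool}

theorem descend (h : IsPath p d) (n : ℕ) : (p 0).descend ((List.range n).map d) = p n := by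
  induction n with
  | zero => rfl
  | succ n ih =>
    rw [h n, ← ih, List.range_succ, List.map_append, Edge.descend, List.foldl_append]
    rfl

theorem finite_small (h : IsPath p d) (h0 : (p 0).SmallFinite) :
    ∃ N, ∀ n ≥ N, 2 < ‖(p n).front‖ := by
  have hinj : Function.Injective fun n : ℕ => (List.range n).map d := fun a b hab => by
    simpa using congrArg List.length hab
  have hfin : {n : ℕ | ‖(p n).front‖ ≤ 2}.Finite := by
    refine (h0.preimage (f := fun n : ℕ => (List.range n).map d) hinj.injOn).subset fun n hn => ?_
    simp only [Set.mem_preimage, Set.mem_ofPred_eq] at hn ⊢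
    rwa [Edge.val_eq_front, h.descend]
  obtain ⟨N, hN⟩ := hfin.bddAbove
  refine ⟨N + 1, fun n hn => ?_⟩
  by_contra! hle
  have : n ≤ N := hN hle
  omega

/-- Once a turn of each kind has been made after time N, both sides are regions that were in front
at some time from N on. -/
theorem sides_of_front (h : IsPath p d) (h0 : ∀ n, ∃ m ≥ n, d m = false)
    (h1 : ∀ n, ∃ m ≥ n, d m = true) {P : ℂ → Prop} {N : ℕ} (hP : ∀ n ≥ N, P (p n).front) :
    ∃ N' ≥ N, ∀ n ≥ N', P (p n).left ∧ P (p n).right := by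
  obtain ⟨a, ha, hda⟩ := h1 N
  obtain ⟨b, hb, hdb⟩ := h0 N
  have hl : ∀ n ≥ a + 1, P (p n).left := by
    intro n hn
    induction n, hn using Nat.le_induction with
    | base => rw [h a, hda]; exact hP a ha
    | succ n hn ih =>
      rw [h n]
      cases d n
      · exact ih
      · exact hP n (by omega)
  have hr : ∀ n ≥ b + 1, P (p n).right := by
    intro n hn
    induction n, hn using Nat.le_induction with
    | base => rw [h b, hdb]; exact hP b hb
    | succ n hn ih =>
      rw [h n]
      cases d n
      · exact hP n (by omega)
      · exact ih
  exact ⟨max (a + 1) (b + 1), by omega, fun n hn => ⟨hl n (by omega), hr n (by omega)⟩⟩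

/-- One side is always the previous front region and the other has modulus at least K, so the lower
bound for the front value gains a factor K/2 > 1 at each step. Recurring turns pass the growth on to
both sides. -/
theorem eventually_large (h : IsPath p d) (h0 : ∀ n, ∃ m ≥ n, d m = false)
    (h1 : ∀ n, ∃ m ≥ n, d m = true) {μ : ℂ} {m : ℕ} {K : ℝ} (hK : 2 < K)
    (hout : Outward μ K (p m)) (K' : ℝ) : ∃ n, Outward μ K' (p n) := by
  have hO : ∀ n ≥ m, Outward μ K (p n) := by
    intro n hn
    induction n, hn using Nat.le_induction with
    | base => exact hout
    | succ n hn ih => rw [h n]; exact ih.child hK.le _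
  have hgrow : ∀ k, (K / 2) ^ k ≤ ‖(p (m + k)).front‖ := by
    intro k
    induction k with
    | zero =>
      have h2 := norm_mul_le_two_front hout.back_le
      have := hout.left_le
      have := hout.right_le
      rw [pow_zero, Nat.add_zero]
      nlinarith
    | succ k ih =>
      have hk := hO (m + (k + 1)) (by omega)
      have h2 := norm_mul_le_two_front hk.back_le
      rw [pow_succ]
      have hp : p (m + (k + 1)) = (p (m + k)).child (d (m + k)) := h (m + k)
      have h3 := hk.left_le
      have h4 := hk.right_le
      rcases hd : d (m + k)
      · have : (p (m + (k + 1))).right = (p (m + k)).front := by rw [hp, hd]; rfl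
        rw [this] at h2
        nlinarith [norm_nonneg (p (m + k)).front]
      · have : (p (m + (k + 1))).left = (p (m + k)).front := by rw [hp, hd]; rfl
        rw [this] at h2
        nlinarith [norm_nonneg (p (m + k)).front]
  obtain ⟨k, hk⟩ := ((tendsto_pow_atTop_atTop_of_one_lt (r := K / 2)
    (by linarith)).eventually_ge_atTop K').exists_forall_of_atTop
  obtain ⟨N, hN, hN2⟩ := h.sides_of_front h0 h1 (P := fun x => K' ≤ ‖x‖) (N := m + k)
    fun n hn => by
      obtain ⟨j, rfl⟩ := Nat.exists_eq_add_of_le (show m ≤ n by omega)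
      exact (hk j (by omega)).trans (hgrow j)
  have := hO N (by omega)
  exact ⟨N, this.vertex, (hN2 N le_rfl).1, (hN2 N le_rfl).2, this.back_le⟩

end IsPath

/-- Two consecutive almost neutral steps of a descending path force `μ` to be close to `4`. -/
theorem norm_sub_four_sq_le {μ x y z w v : ℂ} {S ε : ℝ}
    (hv : x ^ 2 + y ^ 2 + z ^ 2 - x * y * z = μ) (hw : z + w = x * y) (hv' : y + v = x * w)
    (hx : 2 < ‖x‖) (hy : 2 < ‖y‖) (hzw : ‖w‖ ≤ ‖z‖) (hyv : ‖v‖ ≤ ‖y‖)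
    (h1 : ‖z‖ ≤ ‖w‖ + ε) (hε : ε ≤ 1) (hS : 1 ≤ S) (hxS : ‖x‖ ≤ S)
    (hyS : ‖y‖ ≤ S) (hwS : ‖w‖ ≤ S) : ‖μ - 4‖ ^ 2 ≤ (2 * S + 1) ^ 2 * (6 * S * ε) := by
  have hε0 : 0 ≤ ε := by linarith
  have a1 : ‖x‖ * ‖w‖ ≤ 2 * ‖y‖ := by
    rw [← norm_mul, ← hv']
    exact (norm_add_le _ _).trans (by linarith)
  have a2 : ‖x‖ * ‖y‖ ≤ 2 * ‖w‖ + ε := by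
    rw [← norm_mul, ← hw]
    exact (norm_add_le _ _).trans (by linarith)
  have a3 : 2 * ‖w‖ ≤ ‖x‖ * ‖w‖ := by nlinarith [norm_nonneg w]
  have a4 : 2 * ‖y‖ ≤ ‖x‖ * ‖y‖ := by nlinarith [norm_nonneg y]
  -- In the chain 2|w| ≤ |x||w| ≤ 2|y| ≤ |x||y| ≤ 2|w| + ε all terms nearly agree, so the
  -- parallelogram law makes z - w and y - v of order √ε.
  have p1 := parallelogram_law_with_norm ℝ z w
  have p2 := parallelogram_law_with_norm ℝ y v
  rw [hw, norm_mul] at p1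
  rw [hv', norm_mul] at p2
  have b1 : ‖z - w‖ ^ 2 ≤ 6 * S * ε := by
    have c1 : (2 * ‖w‖) ^ 2 ≤ (‖x‖ * ‖y‖) ^ 2 :=
      pow_le_pow_left₀ (by positivity) (by linarith) 2
    have c2 : ‖z‖ ^ 2 ≤ (‖w‖ + ε) ^ 2 := pow_le_pow_left₀ (norm_nonneg _) h1 2
    have c3 : ε * ‖w‖ ≤ ε * S := by gcongr
    have c4 : ε ^ 2 ≤ ε * S := by nlinarith
    nlinarith
  have b2 : ‖y - v‖ ^ 2 ≤ 6 * S * ε := by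
    have c1 : (2 * ‖y‖ - ε) ^ 2 ≤ (‖x‖ * ‖w‖) ^ 2 :=
      pow_le_pow_left₀ (by linarith) (by linarith) 2
    have c2 : ‖v‖ ^ 2 ≤ ‖y‖ ^ 2 := pow_le_pow_left₀ (norm_nonneg _) hyv 2
    have c3 : ε * ‖y‖ ≤ ε * S := by gcongr
    have c4 : 0 ≤ ε * S := by positivity
    nlinarith
  -- For z = w and y = v the relations force μ = 4; in general the error is expressed through these
  -- two differences.
  have key : (μ - 4) * (2 * y) = (-((z - w) * w) + (y - v) * y) * y +
      2 * (-2 * (y - v) + (z - w) * x) := by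
    have e2 : v = x * w - y := by linear_combination hv'
    rw [← hv, e2]
    have e1 : z = x * y - w := by linear_combination hw
    rw [e1]; ring
  set h := √(6 * S * ε) with hh
  have b1' : ‖z - w‖ ≤ h := Real.le_sqrt_of_sq_le b1
  have b2' : ‖y - v‖ ≤ h := Real.le_sqrt_of_sq_le b2
  have hh0 : 0 ≤ h := Real.sqrt_nonneg _
  have n1 : ‖μ - 4‖ * (2 * ‖y‖) ≤ (h * S + h * S) * ‖y‖ + 2 * (2 * h + h * S) := by
    have : ‖μ - 4‖ * (2 * ‖y‖) = ‖(μ - 4) * (2 * y)‖ := by simp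
    rw [this, key]
    refine (norm_add_le _ _).trans ?_
    have d1 : ‖-((z - w) * w) + (y - v) * y‖ ≤ h * S + h * S := by
      refine (norm_add_le _ _).trans ?_
      rw [norm_neg, norm_mul, norm_mul]
      gcongr
    have d2 : ‖-2 * (y - v) + (z - w) * x‖ ≤ 2 * h + h * S := by
      refine (norm_add_le _ _).trans ?_
      rw [norm_mul, norm_mul, norm_neg, Complex.norm_two]
      gcongr
    rw [norm_mul, norm_mul, Complex.norm_two]
    gcongr
  have n2 : ‖μ - 4‖ ≤ (2 * S + 1) * h := by
    have e1 : (‖μ - 4‖ - h * S) * (2 * ‖y‖) ≤ 2 * (2 * h + h * S) := by linarith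
    by_contra! hlt
    have hhS : h ≤ h * S := by nlinarith
    have e2 : h * S + h < ‖μ - 4‖ - h * S := by linarith
    nlinarith [mul_lt_mul_of_pos_right e2 (show 0 < 2 * ‖y‖ by linarith), mul_nonneg hh0 hh0,
      mul_nonneg (by positivity : 0 ≤ h * S + h) (show 0 ≤ 2 * ‖y‖ - 4 by linarith)]
  calc ‖μ - 4‖ ^ 2 ≤ ((2 * S + 1) * h) ^ 2 := by gcongr
    _ = (2 * S + 1) ^ 2 * (6 * S * ε) := by rw [mul_pow, hh, Real.sq_sqrt (by positivity)]

/-- Along a descending path the sum of the three moduli decreases, hence converges, and its steps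
become almost neutral. By `norm_sub_four_sq_le` this is possible only for μ = 4. -/
theorem IsPath.not_descending {p : ℕ → Edge} {d : ℕ → Bool} (h : IsPath p d)
    (h0 : ∀ n, ∃ m ≥ n, d m = false) {μ : ℂ} (hμ : μ ≠ 4) (hv : ∀ n, (p n).Vertex μ) {N : ℕ}
    (hl : ∀ n ≥ N, 2 < ‖(p n).left‖) (hr : ∀ n ≥ N, 2 < ‖(p n).right‖) :
    ∃ n ≥ N, ‖(p n).back‖ ≤ ‖(p n).front‖ := by
  by_contra! hdesc
  set s : ℕ → ℝ := fun n => ‖(p n).left‖ + ‖(p n).right‖ + ‖(p n).back‖ with hs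
  have hstep : ∀ n, s (n + 1) = s n - (‖(p n).back‖ - ‖(p n).front‖) := by
    intro n
    simp only [hs]
    rw [h n]
    cases d n <;> simp only [Edge.child] <;> ring
  have hs0 : ∀ n, 0 ≤ s n := fun n => by positivity
  have hanti : Antitone fun k => s (N + k) := by
    refine antitone_nat_of_succ_le fun k => ?_
    have := hstep (N + k)
    have := hdesc (N + k) (by omega)
    rw [← add_assoc]
    linarith
  have hlim : ∃ a, Tendsto (fun k => s (N + k)) atTop (𝓝 a) :=
    ⟨_, tendsto_atTop_ciInf hanti ⟨0, by rintro _ ⟨k, rfl⟩; exact hs0 _⟩⟩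
  obtain ⟨a, ha⟩ := hlim
  have hdiff : Tendsto (fun k => s (N + k) - s (N + (k + 1))) atTop (𝓝 0) := by
    have := ha.sub (ha.comp (tendsto_add_atTop_nat 1))
    rwa [sub_self] at this
  set S := s N + 1 with hSdef
  have hS : 1 ≤ S := by linarith [hs0 N]
  -- Small enough for the bound of `norm_sub_four_sq_le` to be at most |μ - 4|²/2.
  set θ := min 1 (‖μ - 4‖ ^ 2 / (2 * ((2 * S + 1) ^ 2 * (6 * S)))) with hθ
  have hμ0 : 0 < ‖μ - 4‖ := norm_pos_iff.mpr (sub_ne_zero.mpr hμ)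
  have hθ0 : 0 < θ := lt_min one_pos (by positivity)
  obtain ⟨M, hM⟩ := eventually_atTop.mp (hdiff.eventually (gt_mem_nhds hθ0))
  -- A turn `false` keeps the left region, so the two consecutive steps share the value x.
  obtain ⟨n, hn, hdn⟩ := h0 (N + M)
  obtain ⟨k, rfl⟩ := Nat.exists_eq_add_of_le (show N ≤ n by omega)
  have hle := hanti (Nat.zero_le k)
  simp only [Nat.add_zero] at hle
  have e1 := hM k (by omega)
  rw [← add_assoc, hstep (N + k)] at e1
  have hp := h (N + k)
  rw [hdn] at hp
  have q1 := hdesc (N + k) (by omega)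
  have q2 := hdesc (N + k + 1) (by omega)
  have hfr : (p (N + k + 1)).front = (p (N + k)).left * (p (N + k)).front - (p (N + k)).right := by
    rw [hp]; rfl
  have hbk : (p (N + k + 1)).back = (p (N + k)).right := by rw [hp]; rfl
  rw [hbk] at q2
  have b1 := norm_nonneg (p (N + k)).left
  have b2 := norm_nonneg (p (N + k)).right
  have b3 := norm_nonneg (p (N + k)).back
  have hsk : ‖(p (N + k)).left‖ + ‖(p (N + k)).right‖ + ‖(p (N + k)).back‖ ≤ S := by
    have : s (N + k) ≤ S := by linarith
    exact this
  have fin := norm_sub_four_sq_le (hv (N + k)) (w := (p (N + k)).front)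
    (v := (p (N + k + 1)).front) (by simp [Edge.front]) (by rw [hfr]; ring)
    (hl _ (by omega)) (hr _ (by omega)) q1.le q2.le (ε := θ) (S := S) (by linarith)
    (min_le_left _ _) hS (by linarith) (by linarith) (by linarith)
  have : (2 * S + 1) ^ 2 * (6 * S * θ) ≤ ‖μ - 4‖ ^ 2 / 2 := by
    calc (2 * S + 1) ^ 2 * (6 * S * θ) ≤ (2 * S + 1) ^ 2 * (6 * S *
          (‖μ - 4‖ ^ 2 / (2 * ((2 * S + 1) ^ 2 * (6 * S))))) := by gcongr; exact min_le_right _ _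
      _ = ‖μ - 4‖ ^ 2 / 2 := by field_simp
  nlinarith

/-- The gap identity holds beyond every edge satisfying the BQ-conditions. -/
theorem Edge.Admissible.isGood {τ : ℂ} (hτ : τ ≠ 2) {e : Edge} (he : e.Admissible (τ + 2)) :
    IsGood τ e := by
  by_contra hbad
  let T := {e : Edge // e.Admissible (τ + 2) ∧ ¬ IsGood τ e}
  have hnext : ∀ t : T, ∃ d, ¬ IsGood τ (t.1.child d) := by
    intro t
    by_contra! hc
    exact t.2.2 (.of_children t.2.1 hc)
  choose D hD using hnext
  let nxt : T → T := fun t => ⟨t.1.child (D t), t.2.1.child _, hD t⟩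
  let q : ℕ → T := fun n => nxt^[n] ⟨e, he, hbad⟩
  set p : ℕ → Edge := fun n => (q n).1 with hp
  set d : ℕ → Bool := fun n => D (q n) with hd
  have hpath : IsPath p d := fun n => by
    simp only [hp, hd, q, Function.iterate_succ_apply']
    rfl
  have hadm : ∀ n, (p n).Admissible (τ + 2) := fun n => (q n).2.1
  have hng : ∀ n, ¬ IsGood τ (p n) := fun n => (q n).2.2
  -- A path without further turns `true` would be a fan, and a fan contains a good edge.
  have h1 : ∀ n, ∃ m ≥ n, d m = true := by
    intro n
    by_contra! hc
    have hfan : ∀ k, p (n + k) = (p n).fan k := by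
      intro k
      induction k with
      | zero => rfl
      | succ k ih =>
        rw [← add_assoc, hpath, ih, Edge.fan_succ,
          Bool.eq_false_of_not_eq_true (hc (n + k) (by omega))]
    obtain ⟨k, hk⟩ := (hadm n).exists_fan_isGood
    exact hng (n + k) (by rwa [hfan])
  have h0 : ∀ n, ∃ m ≥ n, d m = false := by
    intro n
    by_contra! hc
    have hfan : ∀ k, p (n + k) = ((p n).mirror.fan k).mirror := by
      intro k
      induction k with
      | zero => rfl
      | succ k ih =>
        rw [← add_assoc, hpath, ih, Edge.fan_succ,
          Bool.eq_true_of_not_eq_false (hc (n + k) (by omega)), Edge.child_mirror]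
        rfl
    obtain ⟨k, hk⟩ := (hadm n).mirror.exists_fan_isGood
    exact hng (n + k) (by rw [hfan]; exact hk.mirror)
  obtain ⟨N, hN⟩ := hpath.finite_small (hadm 0).smallFinite
  obtain ⟨N', -, hN'⟩ := hpath.sides_of_front h0 h1 (P := fun x => 2 < ‖x‖) hN
  obtain ⟨n, hn, hback⟩ := hpath.not_descending h0 (μ := τ + 2)
    (fun h => hτ (by linear_combination h)) (fun n => (hadm n).vertex)
    (fun n hn => (hN' n hn).1) (fun n hn => (hN' n hn).2)
  obtain ⟨K, C, L⟩ := exists_large τ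
  obtain ⟨m, hm⟩ := hpath.eventually_large h0 h1 (m := n)
    (K := min ‖(p n).left‖ ‖(p n).right‖) (lt_min (hN' n hn).1 (hN' n hn).2)
    ⟨(hadm n).vertex, min_le_left _ _, min_le_right _ _, hback⟩ K
  exact hng m (hm.isGood L)

/-! ### The gap identity on the whole tree -/

/-- The regions of the tree: the two regions along an edge and the regions beyond it in either
direction, which are indexed by binary words. -/
abbrev TreeRegion : Type := (Unit ⊕ Unit) ⊕ (List Bool ⊕ List Bool)

/-- The values on all regions, determined by the values around an edge. -/
def Edge.value (e : Edge) : TreeRegion → ℂ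
  | Sum.inl (Sum.inl _) => e.left
  | Sum.inl (Sum.inr _) => e.right
  | Sum.inr (Sum.inl w) => e.val w
  | Sum.inr (Sum.inr w) => e.reverse.val w

/-- The identities for the edge and its reverse multiply to one with Q(x)²Q(y)² on one side and
`edgeFactor_mul_reverse` on the other. By `sideFactor_sq` the gaps of the two sides account for the
quotient up to e^ν. -/
theorem Edge.gap_identity {τ : ℂ} (hτ : τ ≠ 2) {e : Edge} (hv : e.Vertex (τ + 2))
    (hseg : ∀ i, e.value i ∉ realSegment) (hfin : {i | ‖e.value i‖ ≤ 2}.Finite) :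
    (∀ i, e.value i ^ 2 ≠ τ + 2) ∧ Summable (fun i => ‖gap τ (e.value i)‖) ∧
      ∃ k : ℤ, HasSum (fun i => gap τ (e.value i))
        (nu τ + 2 * (Real.pi : ℂ) * Complex.I * (k : ℂ)) := by
  have f1 : e.SmallFinite :=
    hfin.preimage (f := fun w => Sum.inr (Sum.inl w)) fun _ _ _ _ h => by simpa using h
  have f2 : e.reverse.SmallFinite :=
    hfin.preimage (f := fun w => Sum.inr (Sum.inr w)) fun _ _ _ _ h => by simpa using h
  have hl : e.left ∉ realSegment := hseg (Sum.inl (Sum.inl ()))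
  have hr : e.right ∉ realSegment := hseg (Sum.inl (Sum.inr ()))
  have r1 : e.Regular (τ + 2) :=
    ⟨hv, hl, hr, fun w => hseg (Sum.inr (Sum.inl w)), f1⟩
  have r2 : e.reverse.Regular (τ + 2) :=
    ⟨hv.reverse, hl, hr, fun w => hseg (Sum.inr (Sum.inr w)), f2⟩
  have hl2 : e.left ^ 2 ≠ τ + 2 := by
    refine Edge.left_sq_ne hv hl f1 ?_
    -- The left region followed the other way: this child of the reversed edge has the original back
    -- value on its right.
    have := f2.child false
    rwa [Edge.child, Edge.front_reverse] at this
  have hr2 : e.right ^ 2 ≠ τ + 2 := by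
    refine Edge.left_sq_ne hv.mirror hr f1.mirror ?_
    have := (f2.child true).mirror
    rwa [Edge.child, Edge.front_reverse] at this
  have a1 : e.Admissible (τ + 2) := ⟨r1, hl2, hr2⟩
  have a2 : e.reverse.Admissible (τ + 2) := ⟨r2, hl2, hr2⟩
  have g1 := a1.isGood hτ
  have g2 := a2.isGood hτ
  have hsq : ∀ i, e.value i ^ 2 ≠ τ + 2 := by
    rintro ((_ | _) | (w | w))
    · exact hl2
    · exact hr2
    · exact r1.val_sq_ne w
    · exact r2.val_sq_ne w
  refine ⟨hsq, ?_, ?_⟩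
  · have := HasSum.sum (f := fun i => ‖gap τ (e.value i)‖)
      (HasSum.sum (hasSum_unique _) (hasSum_unique _)) (HasSum.sum g1.1.hasSum g2.1.hasSum)
    exact this.summable
  · have hsum := HasSum.sum (f := fun i => gap τ (e.value i))
      (HasSum.sum (hasSum_unique _) (hasSum_unique _))
      (HasSum.sum g1.1.of_norm.hasSum g2.1.of_norm.hasSum)
    have hl0 := ne_zero_of_notMem hl
    have hr0 := ne_zero_of_notMem hr
    have key : Complex.exp (gap τ e.left + gap τ e.right + (gapSum τ e + gapSum τ e.reverse)) =
        Complex.exp (nu τ) := by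
      have h1 := edgeFactor_mul_reverse τ hv hl0 hr0
      rw [← g1.2, ← g2.2] at h1
      have ql := sideFactor_sq hl0 hl2
      have qr := sideFactor_sq hr0 hr2
      have ql0 := sideFactor_ne_zero hl0 hl2
      have qr0 := sideFactor_ne_zero hr0 hr2
      rw [Complex.exp_add, Complex.exp_add, Complex.exp_add]
      apply mul_right_cancel₀ (mul_ne_zero (pow_ne_zero 2 ql0) (pow_ne_zero 2 qr0))
      have e1 : e.reverse.left = e.left := rfl
      have e2 : e.reverse.right = e.right := rfl
      rw [e1, e2] at h1
      calc _ = Complex.exp (gap τ e.left) * Complex.exp (gap τ e.right) *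
            (Complex.exp (gapSum τ e) * (sideFactor τ e.left * sideFactor τ e.right) *
            (Complex.exp (gapSum τ e.reverse) *
              (sideFactor τ e.left * sideFactor τ e.right))) := by ring
        _ = _ := by rw [h1, ql, qr, expNu]; ring
    obtain ⟨k, hk⟩ := Complex.exp_eq_exp_iff_exists_int.mp key
    refine ⟨k, ?_⟩
    have : nu τ + 2 * (Real.pi : ℂ) * Complex.I * (k : ℂ) =
        gap τ e.left + gap τ e.right + (gapSum τ e + gapSum τ e.reverse) := by
      rw [hk]; ring
    rw [this]
    exact hsum

end

end PuncturedTorus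

/-! ### Farey coordinates of the regions and Markoff maps. -/

namespace PuncturedTorus

noncomputable section

/-! ### The Stern–Brocot enumeration of primitive vectors -/

/-- The coordinates, in terms of the two regions along an edge, of the region beyond the edge
with a given word. -/
def farey : List Bool → ℕ × ℕ
  | [] => (1, 1)
  | false :: w => ((farey w).1 + (farey w).2, (farey w).2)
  | true :: w => ((farey w).1, (farey w).1 + (farey w).2)

theorem farey_pos (w : List Bool) : 0 < (farey w).1 ∧ 0 < (farey w).2 := by
  induction w with
  | nil => simp [farey]
  | cons d w ih => cases d <;> simp only [farey] <;> omega

theorem farey_coprime (w : List Bool) : Nat.Coprime (farey w).1 (farey w).2 := by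
  induction w with
  | nil => simp [farey]
  | cons d w ih => cases d <;> simpa [farey] using ih

/-- The first letter tells which coordinate is larger, and they are equal only for the empty word.
-/
theorem farey_injective : Function.Injective farey := by
  intro v
  induction v with
  | nil =>
    rintro (_ | ⟨_ | _, w⟩) h
    · rfl
    all_goals
      have := farey_pos w
      simp only [farey, Prod.mk.injEq] at h
      omega
  | cons d v ih =>
    have hv := farey_pos v
    rintro (_ | ⟨d', w⟩) h
    · cases d <;> simp only [farey, Prod.mk.injEq] at h <;> omega
    · have hw := farey_pos w
      have : d = d' ∧ farey v = farey w := by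
        rw [Prod.ext_iff]
        cases d <;> cases d' <;> simp only [farey, Prod.mk.injEq] at h ⊢ <;>
          simp only [reduceCtorEq, true_and, false_and] <;> omega
      rw [this.1, ih this.2]

/-- The subtractive Euclidean algorithm, which ends at (1, 1) for coprime numbers. -/
theorem exists_farey {p q : ℕ} (hp : 0 < p) (hq : 0 < q) (h : Nat.Coprime p q) :
    ∃ w, farey w = (p, q) := by
  induction hn : p + q using Nat.strong_induction_on generalizing p q with
  | _ n ih =>
    rcases lt_trichotomy p q with hlt | rfl | hlt
    · obtain ⟨w, hw⟩ := ih (p + (q - p)) (by omega) hp (by omega)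
        ((Nat.coprime_sub_self_right hlt.le).mpr h) rfl
      refine ⟨true :: w, ?_⟩
      simp only [farey, hw]
      congr 1; omega
    · have : p = 1 := by simpa using h
      exact ⟨[], by rw [this]; rfl⟩
    · obtain ⟨w, hw⟩ := ih ((p - q) + q) (by omega) (by omega) hq
        ((Nat.coprime_sub_self_left hlt.le).mpr h) rfl
      refine ⟨false :: w, ?_⟩
      simp only [farey, hw]
      congr 1; omega

/-- The primitive vector of a region. -/
def TreeRegion.vec : TreeRegion → ℤ × ℤ
  | Sum.inl (Sum.inl _) => (1, 0)
  | Sum.inl (Sum.inr _) => (0, 1)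
  | Sum.inr (Sum.inl w) => ((farey w).1, (farey w).2)
  | Sum.inr (Sum.inr w) => ((farey w).1, -(farey w).2)

/-- Up to sign, the words in the two directions give vectors in different open quadrants, and the
two sides of the edge give the axes. -/
theorem TreeRegion.vec_injective_up_to_sign {i j : TreeRegion}
    (h : i.vec = j.vec ∨ i.vec = -j.vec) : i = j := by
  have key : ∀ v w, ((farey v).1 : ℤ) = (farey w).1 → ((farey v).2 : ℤ) = (farey w).2 → v = w :=
    fun v w h1 h2 => farey_injective (Prod.ext (by exact_mod_cast h1) (by exact_mod_cast h2))
  rcases i with (_ | _) | (v | v) <;> rcases j with (_ | _) | (w | w) <;>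
    simp only [TreeRegion.vec, Prod.neg_mk, Prod.mk.injEq] at h <;>
    (try have hv := farey_pos v) <;> (try have hw := farey_pos w) <;>
    (try (exfalso; omega)) <;> (try rfl)
  · rw [key v w (by omega) (by omega)]
  · rw [key v w (by omega) (by omega)]

theorem TreeRegion.exists_vec {a b : ℤ} (h : IsCoprime a b) :
    ∃ i : TreeRegion, i.vec = (a, b) ∨ i.vec = -(a, b) := by
  rw [Int.isCoprime_iff_gcd_eq_one] at h
  rcases eq_or_ne a 0 with rfl | ha
  · rw [Int.gcd_zero_left] at h
    refine ⟨Sum.inl (Sum.inr ()), ?_⟩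
    rcases Int.natAbs_eq_iff.mp h with rfl | rfl <;> simp [TreeRegion.vec]
  rcases eq_or_ne b 0 with rfl | hb
  · rw [Int.gcd_zero_right] at h
    refine ⟨Sum.inl (Sum.inl ()), ?_⟩
    rcases Int.natAbs_eq_iff.mp h with rfl | rfl <;> simp [TreeRegion.vec]
  obtain ⟨w, hw⟩ := exists_farey (Int.natAbs_pos.mpr ha) (Int.natAbs_pos.mpr hb) h
  by_cases hs : 0 < a ∧ 0 < b ∨ a < 0 ∧ b < 0
  · refine ⟨Sum.inr (Sum.inl w), ?_⟩
    simp only [TreeRegion.vec, hw, Prod.neg_mk, Prod.mk.injEq]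
    omega
  · refine ⟨Sum.inr (Sum.inr w), ?_⟩
    simp only [TreeRegion.vec, hw, Prod.neg_mk, Prod.mk.injEq]
    omega

/-! ### Markoff maps in coordinates -/

/-- The region with homogeneous coordinates `v`. -/
def Region.ofVec (v : ℤ × ℤ) : Region :=
  if v.2 = 0 then none else some ((v.1 : ℚ) / v.2)

theorem Region.ofVec_of_eq_zero {v : ℤ × ℤ} (h : v.2 = 0) : Region.ofVec v = none := if_pos h

theorem Region.ofVec_of_ne_zero {v : ℤ × ℤ} (h : v.2 ≠ 0) :
    Region.ofVec v = some ((v.1 : ℚ) / v.2) := if_neg h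

theorem Region.ofVec_neg (v : ℤ × ℤ) : Region.ofVec (-v) = Region.ofVec v := by
  simp [Region.ofVec, neg_div_neg_eq]

theorem Region.coords_ofVec {v : ℤ × ℤ} (h : IsCoprime v.1 v.2) :
    ((Region.ofVec v).num, (Region.ofVec v).den) = v ∨
      ((Region.ofVec v).num, (Region.ofVec v).den) = -v := by
  obtain ⟨a, b⟩ := v
  simp only at h
  rw [Int.isCoprime_iff_gcd_eq_one] at h
  rcases lt_trichotomy b 0 with hb | rfl | hb
  · right
    rw [← Region.ofVec_neg]
    have hc : Nat.Coprime (-a).natAbs (-b).natAbs := by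
      rw [Int.natAbs_neg, Int.natAbs_neg]; exact h
    have h1 := Rat.num_div_eq_of_coprime (a := -a) (b := -b) (by omega) hc
    have h2 := Rat.den_div_eq_of_coprime (a := -a) (b := -b) (by omega) hc
    rw [Prod.neg_mk, Region.ofVec_of_ne_zero (by simpa using hb.ne)]
    exact Prod.ext h1 h2
  · rw [Int.gcd_zero_right] at h
    rw [Region.ofVec_of_eq_zero rfl]
    rcases Int.natAbs_eq_iff.mp h with rfl | rfl <;> simp [Region.num, Region.den]
  · left
    have h1 := Rat.num_div_eq_of_coprime (a := a) (b := b) hb h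
    have h2 := Rat.den_div_eq_of_coprime (a := a) (b := b) hb h
    rw [Region.ofVec_of_ne_zero hb.ne']
    exact Prod.ext h1 h2

theorem Region.ofVec_coords (X : Region) : Region.ofVec (X.num, X.den) = X := by
  match X with
  | none => exact Region.ofVec_of_eq_zero rfl
  | some r =>
    rw [Region.ofVec_of_ne_zero (by simp [Region.den])]
    exact congrArg some r.num_div_den

theorem Region.isCoprime (X : Region) : IsCoprime X.num X.den := by
  match X with
  | none => exact isCoprime_one_left
  | some r => exact Int.isCoprime_iff_gcd_eq_one.mpr r.reduced

theorem TreeRegion.isCoprime_vec (i : TreeRegion) : IsCoprime i.vec.1 i.vec.2 := by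
  rcases i with (_ | _) | (v | v)
  · exact isCoprime_one_left
  · exact isCoprime_one_right
  · exact Nat.isCoprime_iff_coprime.mpr (farey_coprime v)
  · exact (Nat.isCoprime_iff_coprime.mpr (farey_coprime v)).neg_right

/-- The regions of the tree are the vertices of the Farey triangulation. -/
theorem bijective_ofVec : Function.Bijective fun i : TreeRegion => Region.ofVec i.vec := by
  refine ⟨fun i j h => ?_, fun X => ?_⟩
  · apply TreeRegion.vec_injective_up_to_sign
    simp only at h
    have h1 := Region.coords_ofVec i.isCoprime_vec
    have h2 := Region.coords_ofVec j.isCoprime_vec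
    rw [h] at h1
    rcases h1 with h1 | h1 <;> rcases h2 with h2 | h2
    · exact Or.inl (h1.symm.trans h2)
    · exact Or.inr (h1.symm.trans h2)
    · exact Or.inr (by rw [← h2, h1, neg_neg])
    · exact Or.inl (neg_injective (h1.symm.trans h2))
  · obtain ⟨i, hi⟩ := TreeRegion.exists_vec X.isCoprime
    refine ⟨i, ?_⟩
    rcases hi with hi | hi <;> simp only [hi, Region.ofVec_neg, Region.ofVec_coords]

/-- The determinant of two vectors is a unit. -/
def Unimodular (u v : ℤ × ℤ) : Prop :=
  u.1 * v.2 - v.1 * u.2 = 1 ∨ u.1 * v.2 - v.1 * u.2 = -1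

theorem Unimodular.isCoprime_left {u v : ℤ × ℤ} (h : Unimodular u v) : IsCoprime u.1 u.2 := by
  rcases h with h | h
  · exact ⟨v.2, -v.1, by linear_combination h⟩
  · exact ⟨-v.2, v.1, by linear_combination -h⟩

theorem Unimodular.symm {u v : ℤ × ℤ} (h : Unimodular u v) : Unimodular v u := by
  rcases h with h | h
  · exact Or.inr (by linear_combination -h)
  · exact Or.inl (by linear_combination -h)

theorem Unimodular.add_right {u v : ℤ × ℤ} (h : Unimodular u v) : Unimodular u (u + v) := by
  rcases h with h | h
  · exact Or.inl (by simp only [Prod.fst_add, Prod.snd_add]; linear_combination h)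
  · exact Or.inr (by simp only [Prod.fst_add, Prod.snd_add]; linear_combination h)

theorem Unimodular.add_left {u v : ℤ × ℤ} (h : Unimodular u v) : Unimodular (u + v) v := by
  rw [add_comm]
  exact h.symm.add_right.symm

theorem Unimodular.neg_right {u v : ℤ × ℤ} (h : Unimodular u v) : Unimodular u (-v) := by
  rcases h with h | h
  · exact Or.inr (by simp only [Prod.fst_neg, Prod.snd_neg]; linear_combination -h)
  · exact Or.inl (by simp only [Prod.fst_neg, Prod.snd_neg]; linear_combination -h)

theorem Unimodular.fareyAdj {u v : ℤ × ℤ} (h : Unimodular u v) :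
    FareyAdj (Region.ofVec u) (Region.ofVec v) := by
  have h1 := Region.coords_ofVec h.isCoprime_left
  have h2 := Region.coords_ofVec h.symm.isCoprime_left
  simp only [Prod.ext_iff, Prod.fst_neg, Prod.snd_neg] at h1 h2
  unfold FareyAdj
  unfold Unimodular at h
  rcases h1 with ⟨a1, a2⟩ | ⟨a1, a2⟩ <;> rcases h2 with ⟨b1, b2⟩ | ⟨b1, b2⟩ <;>
    rw [a1, a2, b1, b2] <;> (try simp only [neg_mul, mul_neg, neg_neg]) <;> omega

theorem Unimodular.meetAtVertex {u v : ℤ × ℤ} (h : Unimodular u v) :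
    MeetAtVertex (Region.ofVec u) (Region.ofVec v) (Region.ofVec (u + v)) :=
  ⟨h.fareyAdj, h.add_left.symm.fareyAdj, h.add_right.symm.fareyAdj⟩

theorem Unimodular.meetAtVertex_sub {u v : ℤ × ℤ} (h : Unimodular u v) :
    MeetAtVertex (Region.ofVec u) (Region.ofVec v) (Region.ofVec (u - v)) := by
  have := h.neg_right.meetAtVertex
  rwa [Region.ofVec_neg, ← sub_eq_add_neg] at this

/-- The two ends could agree only if u + v = ±(u - v), that is, if u or v were zero. -/
theorem Unimodular.isEdge {u v : ℤ × ℤ} (h : Unimodular u v) :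
    IsEdge (Region.ofVec u) (Region.ofVec v) (Region.ofVec (u - v)) (Region.ofVec (u + v)) := by
  refine ⟨h.meetAtVertex_sub, h.meetAtVertex, fun heq => ?_⟩
  have h1 := Region.coords_ofVec h.add_left.isCoprime_left
  have h2 := Region.coords_ofVec h.neg_right.add_left.isCoprime_left
  rw [← sub_eq_add_neg, heq] at h2
  simp only [Prod.ext_iff, Prod.fst_neg, Prod.snd_neg, Prod.fst_add, Prod.snd_add,
    Prod.fst_sub, Prod.snd_sub] at h1 h2
  have key : (u.1 = 0 ∧ u.2 = 0) ∨ (v.1 = 0 ∧ v.2 = 0) := by omega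
  unfold Unimodular at h
  rcases key with ⟨a, b⟩ | ⟨a, b⟩ <;> simp [a, b] at h

/-- The edge of the tree along the regions with coordinates `u` and `v`. -/
def markoffEdge (φ : Region → ℂ) (u v : ℤ × ℤ) : Edge :=
  ⟨φ (Region.ofVec u), φ (Region.ofVec v), φ (Region.ofVec (u - v))⟩

theorem markoffEdge_front {μ : ℂ} {φ : Region → ℂ} (hφ : IsMarkoffMap μ φ) {u v : ℤ × ℤ}
    (h : Unimodular u v) : (markoffEdge φ u v).front = φ (Region.ofVec (u + v)) := by
  have := hφ.2 _ _ _ _ h.isEdge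
  simp only [markoffEdge, Edge.front]
  linear_combination this

/-- Continuing an edge replaces (u, v) by (u, u + v) or (u + v, v), so a region has its Farey pair
as coordinates in the basis u, v. -/
theorem markoffEdge_val {μ : ℂ} {φ : Region → ℂ} (hφ : IsMarkoffMap μ φ) {u v : ℤ × ℤ}
    (h : Unimodular u v) (w : List Bool) : (markoffEdge φ u v).val w =
      φ (Region.ofVec (((farey w).1 : ℤ) • u + ((farey w).2 : ℤ) • v)) := by
  induction w generalizing u v with
  | nil => simpa [farey] using markoffEdge_front hφ h
  | cons d w ih =>
    cases d
    · have : (markoffEdge φ u v).child false = markoffEdge φ u (u + v) := by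
        rw [Edge.child, markoffEdge_front hφ h, markoffEdge, markoffEdge, sub_add_cancel_left,
          Region.ofVec_neg]
      rw [Edge.val_cons, this, ih h.add_right]
      congr 2
      simp only [farey]; push_cast; module
    · have : (markoffEdge φ u v).child true = markoffEdge φ (u + v) v := by
        rw [Edge.child, markoffEdge_front hφ h, markoffEdge, markoffEdge, add_sub_cancel_right]
      rw [Edge.val_cons, this, ih h.add_left]
      congr 2
      simp only [farey]; push_cast; module

theorem markoffEdge_value {μ : ℂ} {φ : Region → ℂ} (hφ : IsMarkoffMap μ φ) (i : TreeRegion) :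
    (markoffEdge φ (1, 0) (0, 1)).value i = φ (Region.ofVec i.vec) := by
  have h : Unimodular (1, 0) (0, 1) := Or.inl (by norm_num)
  have hrev : (markoffEdge φ (1, 0) (0, 1)).reverse = markoffEdge φ (1, 0) (-(0, 1)) := by
    rw [Edge.reverse, markoffEdge_front hφ h, markoffEdge, markoffEdge, sub_neg_eq_add,
      Region.ofVec_neg]
  rcases i with (_ | _) | (w | w)
  · rfl
  · rfl
  · simp [Edge.value, markoffEdge_val hφ h, TreeRegion.vec]
  · rw [Edge.value, hrev, markoffEdge_val hφ h.neg_right]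
    simp [TreeRegion.vec]

/-- The gap identity for generalized Markoff maps. -/
theorem markoff_gap_identity {μ : ℂ} {φ : Region → ℂ} (hμ : μ ≠ 4) (hφ : IsMarkoffMap μ φ)
    (hBQ : MarkoffBQ φ) :
    (∀ X, φ X ^ 2 ≠ μ) ∧ Summable (fun X : Region => ‖gap (μ - 2) (φ X)‖) ∧
      ∃ k : ℤ, HasSum (fun X : Region => gap (μ - 2) (φ X))
        (nu (μ - 2) + 2 * (Real.pi : ℂ) * Complex.I * (k : ℂ)) := by
  let σ : TreeRegion ≃ Region := Equiv.ofBijective _ bijective_ofVec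
  set e := markoffEdge φ (1, 0) (0, 1) with he
  have hval : ∀ i, e.value i = φ (σ i) := markoffEdge_value hφ
  have h : Unimodular (1, 0) (0, 1) := Or.inl (by norm_num)
  have hv : e.Vertex (μ - 2 + 2) := by
    rw [sub_add_cancel]
    exact hφ.1 _ _ _ h.meetAtVertex_sub
  obtain ⟨h1, h2, k, h3⟩ := Edge.gap_identity (τ := μ - 2)
    (fun h => hμ (by linear_combination h)) hv (fun i => by rw [hval]; exact hBQ.1 _) (by
      simp only [hval]
      exact hBQ.2.preimage σ.injective.injOn)
  simp only [hval, sub_add_cancel] at h1 h2 h3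
  refine ⟨fun X => ?_, ?_, k, ?_⟩
  · have := h1 (σ.symm X)
    rwa [σ.apply_symm_apply] at this
  · exact σ.summable_iff.mp h2
  · exact σ.hasSum_iff.mp h3

end

end PuncturedTorus

/-! ### Cancellation in free groups. -/

namespace PuncturedTorus

/-! ### Common prefixes and cancellation in free groups -/

section Overlap

variable {β : Type*} [DecidableEq β]

/-- The length of the longest common prefix of two lists. -/
def commonPrefix : List β → List β → ℕ
  | a :: l, b :: m => if a = b then commonPrefix l m + 1 else 0
  | _, _ => 0

theorem commonPrefix_comm (l m : List β) : commonPrefix l m = commonPrefix m l := by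
  induction l generalizing m with
  | nil => cases m <;> rfl
  | cons a l ih =>
    cases m with
    | nil => rfl
    | cons b m => simp only [commonPrefix, ih m, eq_comm]

/-- The ultrametric inequality, through which cancellations are compared below. -/
theorem min_commonPrefix_le (l m n : List β) :
    min (commonPrefix l m) (commonPrefix m n) ≤ commonPrefix l n := by
  induction l generalizing m n with
  | nil => cases m <;> simp [commonPrefix]
  | cons a l ih =>
    match m, n with
    | [], _ => simp [commonPrefix]
    | b :: m, [] => simp [commonPrefix]
    | b :: m, c :: n =>
      have := ih m n
      by_cases h1 : a = b
      · by_cases h2 : b = c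
        · subst h1; subst h2
          simp only [commonPrefix, if_true]
          omega
        · simp [commonPrefix, h2]
      · simp [commonPrefix, h1]

theorem take_eq_of_le_commonPrefix {k : ℕ} {l m : List β} (h : k ≤ commonPrefix l m) :
    l.take k = m.take k := by
  induction l generalizing m k with
  | nil =>
    obtain rfl : k = 0 := by cases m <;> simpa [commonPrefix] using h
    simp
  | cons a l ih =>
    cases m with
    | nil =>
      obtain rfl : k = 0 := by simpa [commonPrefix] using h
      simp
    | cons b m =>
      cases k with
      | zero => simp
      | succ k =>
        by_cases hab : a = b
        · rw [commonPrefix, if_pos hab] at h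
          rw [List.take_succ_cons, List.take_succ_cons, hab, ih (Nat.le_of_succ_le_succ h)]
        · rw [commonPrefix, if_neg hab] at h
          omega

end Overlap

theorem invRev_take_invRev {γ : Type*} (l : List (γ × Bool)) (k : ℕ) :
    FreeGroup.invRev ((FreeGroup.invRev l).take k) = l.drop (l.length - k) := by
  simp [FreeGroup.invRev, List.take_reverse, List.map_drop, Function.comp_def]

/-- The value of a letter. -/
def letter {ι γ : Type*} (f : ι → FreeGroup γ) (x : ι × Bool) : FreeGroup γ :=
  cond x.2 (f x.1) (f x.1)⁻¹

theorem lift_mk_cons {ι γ : Type*} (f : ι → FreeGroup γ) (x : ι × Bool) (l : List (ι × Bool)) :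
    FreeGroup.lift f (FreeGroup.mk (x :: l)) = letter f x * FreeGroup.lift f (FreeGroup.mk l) := by
  simp [FreeGroup.lift_mk, letter]

section FreeGroupMetric

open FreeGroup

variable {α : Type*} [DecidableEq α]

theorem isReduced_invRev {l : List (α × Bool)} (h : IsReduced l) : IsReduced (invRev l) := by
  rw [isReduced_iff_reduce_eq, reduce_invRev, h.reduce_eq]

theorem norm_mk_of_isReduced {l : List (α × Bool)} (h : IsReduced l) :
    FreeGroup.norm (FreeGroup.mk l) = l.length := by
  rw [FreeGroup.norm, toWord_mk, h.reduce_eq]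

/-- The length of the longest common prefix of two elements of a free group. -/
def overlap (g h : FreeGroup α) : ℕ := commonPrefix g.toWord h.toWord

theorem overlap_comm (g h : FreeGroup α) : overlap g h = overlap h g := commonPrefix_comm _ _

theorem min_overlap_le (g h k : FreeGroup α) :
    min (overlap g h) (overlap h k) ≤ overlap g k := min_commonPrefix_le _ _ _

theorem norm_inv_mk_mul_mk {l m : List (α × Bool)} (hl : IsReduced l) (hm : IsReduced m) :
    FreeGroup.norm ((FreeGroup.mk l)⁻¹ * FreeGroup.mk m) + 2 * commonPrefix l m =
      l.length + m.length := by
  induction l generalizing m with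
  | nil =>
    rw [show FreeGroup.mk ([] : List (α × Bool)) = 1 from rfl, inv_one, one_mul,
      norm_mk_of_isReduced hm]
    cases m <;> simp [commonPrefix]
  | cons a l ih =>
    cases m with
    | nil =>
      rw [show FreeGroup.mk ([] : List (α × Bool)) = 1 from rfl, mul_one, norm_inv_eq,
        norm_mk_of_isReduced hl]
      simp [commonPrefix]
    | cons b m =>
      by_cases hab : a = b
      · subst hab
        have e : (FreeGroup.mk (a :: l))⁻¹ * FreeGroup.mk (a :: m) =
            (FreeGroup.mk l)⁻¹ * FreeGroup.mk m := by
          rw [← List.singleton_append, ← List.singleton_append (l := m), ← mul_mk, ← mul_mk]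
          group
        have := ih (m := m) (List.IsChain.tail hl) (List.IsChain.tail hm)
        rw [e, commonPrefix, if_pos rfl, List.length_cons, List.length_cons]
        omega
      · rw [commonPrefix, if_neg hab, inv_mk, mul_mk, norm_mk_of_isReduced]
        · simp
        · refine List.IsChain.append (isReduced_invRev hl) hm ?_
          intro x hx y hy hxy
          rw [invRev_cons] at hx
          simp only [invRev, List.map_cons, List.map_nil, List.reverse_singleton,
            List.getLast?_concat, Option.mem_def, Option.some.injEq] at hx
          simp only [List.head?_cons, Option.mem_def, Option.some.injEq] at hy
          subst hx; subst hy
          simp only at hxy ⊢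
          rcases a with ⟨a1, a2⟩
          rcases b with ⟨b1, b2⟩
          simp only at hxy
          subst hxy
          cases a2 <;> cases b2 <;> simp_all

theorem norm_mul_add_overlap (g h : FreeGroup α) :
    FreeGroup.norm (g * h) + 2 * overlap g⁻¹ h = FreeGroup.norm g + FreeGroup.norm h := by
  have := norm_inv_mk_mul_mk (isReduced_toWord (x := g⁻¹)) (isReduced_toWord (x := h))
  rw [mk_toWord, mk_toWord, inv_inv] at this
  rw [overlap, this]
  exact congrArg (· + h.toWord.length) norm_inv_eq

/-- Equivalently, y² is longer than y. Otherwise the reduced word of y would have two inverse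
letters in the middle, or a middle letter equal to its own inverse. -/
theorem norm_lt_norm_mul_self {y : FreeGroup α} (hy : y ≠ 1) :
    2 * overlap y⁻¹ y < FreeGroup.norm y := by
  by_contra! h
  have hred := isReduced_toWord (x := y)
  have hpos : 0 < FreeGroup.norm y := Nat.pos_of_ne_zero fun h0 => hy (norm_eq_zero.mp h0)
  rw [FreeGroup.norm] at h hpos
  rw [overlap, toWord_inv] at h
  set l := y.toWord with hl
  set k := commonPrefix (invRev l) l
  have key : ∀ i (_ : i < k) (hi : i < l.length),
      l[i] = ((l[l.length - 1 - i]).1, !(l[l.length - 1 - i]).2) := by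
    intro i hik hi
    have h1 := take_eq_of_le_commonPrefix (le_refl k)
    have h2 : (invRev l)[i]'(by rwa [invRev_length]) = l[i] := by
      have h3 : ((invRev l).take k)[i]'(by
        rw [List.length_take, invRev_length]; omega) = (l.take k)[i]'(by
        rw [List.length_take]; omega) := by congr 1
      simpa using h3
    rw [← h2]
    simp [invRev]
  have hk : (l.length - 1) / 2 < k := by omega
  have hi : (l.length - 1) / 2 < l.length := by omega
  have h1 := key _ hk hi
  rcases Nat.even_or_odd' l.length with ⟨m, hm | hm⟩
  · have e1 : l.length - 1 - (l.length - 1) / 2 = (l.length - 1) / 2 + 1 := by omega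
    have h2 := (List.isChain_iff_getElem.mp hred) ((l.length - 1) / 2) (by omega)
    simp only [e1] at h1
    rw [h1] at h2
    have := h2 rfl
    simp at this
  · have e1 : l.length - 1 - (l.length - 1) / 2 = (l.length - 1) / 2 := by omega
    simp only [e1] at h1
    have := congrArg Prod.snd h1
    simp at this

/-- If the two halves of `x` cancel against the two sides of `z`, then conjugation shortens the
pair `x, z * x`. -/
theorem exists_conj_shorter {x z : FreeGroup α}
    (h1 : 2 * overlap z⁻¹ x = FreeGroup.norm x) (h2 : 2 * overlap x⁻¹ z = FreeGroup.norm x)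
    (hle : FreeGroup.norm x ≤ FreeGroup.norm z) :
    ∃ q : FreeGroup α, FreeGroup.norm (q⁻¹ * x * q) + FreeGroup.norm (q⁻¹ * (z * x) * q) ≤
      FreeGroup.norm z := by
  set k := overlap z⁻¹ x with hk
  have hk2 : overlap x⁻¹ z = k := by omega
  have t1 := take_eq_of_le_commonPrefix (le_of_eq hk)
  have t2 := take_eq_of_le_commonPrefix (le_of_eq hk2.symm)
  rw [toWord_inv] at t1 t2
  rw [FreeGroup.norm] at h1 hle
  rw [FreeGroup.norm] at hle
  set X := x.toWord with hX
  set Z := z.toWord with hZ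
  have d1 := invRev_take_invRev X k
  have d2 := invRev_take_invRev Z k
  rw [t2] at d1
  rw [t1] at d2
  -- With P and Q the first k letters of x and z, one has x = PQ⁻¹ and z = QMP⁻¹. Conjugation by Q
  -- turns x and zx into Q⁻¹P and M, of total length at most 2k + (|z| - 2k).
  have ex : x = FreeGroup.mk (X.take k) * (FreeGroup.mk (Z.take k))⁻¹ := by
    rw [inv_mk, d1, mul_mk, show X.length - k = k by omega, List.take_append_drop, hX, mk_toWord]
  have ez : z = FreeGroup.mk (Z.take k) * FreeGroup.mk ((Z.drop k).take (Z.length - 2 * k)) *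
      (FreeGroup.mk (X.take k))⁻¹ := by
    have e1 : Z.drop (Z.length - k) = (Z.drop k).drop (Z.length - 2 * k) := by
      rw [List.drop_drop]; congr 1; omega
    rw [inv_mk, d2, mul_assoc, mul_mk, e1, List.take_append_drop, mul_mk, List.take_append_drop,
      hZ, mk_toWord]
  refine ⟨FreeGroup.mk (Z.take k), ?_⟩
  set P := FreeGroup.mk (X.take k)
  set Q := FreeGroup.mk (Z.take k)
  set M := FreeGroup.mk ((Z.drop k).take (Z.length - 2 * k)) with hM
  have e1 : Q⁻¹ * x * Q = Q⁻¹ * P := by rw [ex]; group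
  have e2 : Q⁻¹ * (z * x) * Q = M := by rw [ex, ez]; group
  have n1 : FreeGroup.norm P ≤ k := norm_mk_le.trans (by simp)
  have n2 : FreeGroup.norm Q ≤ k := norm_mk_le.trans (by simp)
  have n3 : FreeGroup.norm M ≤ Z.length - 2 * k := norm_mk_le.trans (by simp)
  have n4 := norm_mul_le Q⁻¹ P
  rw [norm_inv_eq] at n4
  have n5 : FreeGroup.norm z = Z.length := rfl
  rw [e1, e2, n5]
  omega

/-! ### Words in a pair of elements -/

/-- In a product of letters, every letter keeps an uncancelled part. -/
def NielsenReduced {ι : Type*} (f : ι → FreeGroup α) : Prop :=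
  (∀ z x : ι × Bool, IsReduced [z, x] →
    overlap (letter f z)⁻¹ (letter f x) < FreeGroup.norm (letter f x)) ∧
  ∀ z x y : ι × Bool, IsReduced [z, x] → IsReduced [x, y] →
    overlap (letter f z)⁻¹ (letter f x) + overlap (letter f x)⁻¹ (letter f y) <
      FreeGroup.norm (letter f x)

/-- If g' is the product after x, then x and xg' share a prefix of length |x| - `overlap` x⁻¹ g',
longer than the overlap of z⁻¹ with x. By the ultrametric inequality the later letters cannot affect
that overlap. -/
theorem NielsenReduced.overlap_eq {ι : Type*} {f : ι → FreeGroup α} (hf : NielsenReduced f)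
    {z x : ι × Bool} {l : List (ι × Bool)} (h : IsReduced (z :: x :: l)) :
    overlap (letter f z)⁻¹ (FreeGroup.lift f (FreeGroup.mk (x :: l))) =
        overlap (letter f z)⁻¹ (letter f x) ∧
      overlap (letter f z)⁻¹ (letter f x) <
        FreeGroup.norm (FreeGroup.lift f (FreeGroup.mk (x :: l))) := by
  have hzx : IsReduced [z, x] := h.infix ⟨[], l, rfl⟩
  induction l generalizing z x with
  | nil =>
    have : FreeGroup.lift f (FreeGroup.mk [x]) = letter f x := by
      rw [lift_mk_cons, show FreeGroup.mk ([] : List (ι × Bool)) = 1 from rfl, _root_.map_one, mul_one]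
    rw [this]
    exact ⟨rfl, hf.1 z x hzx⟩
  | cons y l ih =>
    have hxy : IsReduced [x, y] := h.infix ⟨[z], l, rfl⟩
    obtain ⟨i1, i2⟩ := ih (z := x) (x := y) (List.IsChain.tail h) hxy
    rw [lift_mk_cons]
    set g' := FreeGroup.lift f (FreeGroup.mk (y :: l))
    have hN := hf.2 z x y hzx hxy
    have m1 := norm_mul_add_overlap (letter f x) g'
    have m2 := norm_mul_add_overlap (letter f x)⁻¹ (letter f x * g')
    rw [inv_mul_cancel_left, inv_inv, norm_inv_eq] at m2
    have u1 := min_overlap_le (letter f z)⁻¹ (letter f x) (letter f x * g')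
    have u2 := min_overlap_le (letter f z)⁻¹ (letter f x * g') (letter f x)
    rw [overlap_comm (letter f x * g')] at u2
    omega

theorem NielsenReduced.two_le_norm {ι : Type*} {f : ι → FreeGroup α} (hf : NielsenReduced f)
    {x y : ι × Bool} {l : List (ι × Bool)} (h : IsReduced (x :: y :: l)) :
    2 ≤ FreeGroup.norm (FreeGroup.lift f (FreeGroup.mk (x :: y :: l))) := by
  have hxy : IsReduced [x, y] := h.infix ⟨[], l, rfl⟩
  obtain ⟨i1, i2⟩ := hf.overlap_eq h
  rw [lift_mk_cons]
  have m1 := norm_mul_add_overlap (letter f x) (FreeGroup.lift f (FreeGroup.mk (y :: l)))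
  -- The triple x, x, y serves to bound the overlap of x⁻¹ with y strictly below |x|.
  have hx : FreeGroup.IsReduced [x, x] := by simp [FreeGroup.IsReduced]
  have := hf.2 x x y hx hxy
  omega

theorem NielsenReduced.exists_letter {ι : Type*} {f : ι → FreeGroup α}
    (hf : NielsenReduced f) (hs : Function.Surjective (FreeGroup.lift f)) [DecidableEq ι]
    {g : FreeGroup α} (hg : FreeGroup.norm g = 1) : ∃ x, letter f x = g := by
  obtain ⟨w, rfl⟩ := hs g
  have key : ∀ l : List (ι × Bool), IsReduced l →
      FreeGroup.norm (FreeGroup.lift f (FreeGroup.mk l)) = 1 →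
        ∃ x, letter f x = FreeGroup.lift f (FreeGroup.mk l) := by
    intro l hl h1
    match l, hl with
    | [], _ =>
      rw [show FreeGroup.mk ([] : List (ι × Bool)) = 1 from rfl, _root_.map_one,
        FreeGroup.norm_one] at h1
      omega
    | [x], _ =>
      exact ⟨x, by rw [lift_mk_cons, show FreeGroup.mk ([] : List (ι × Bool)) = 1 from rfl,
        _root_.map_one, mul_one]⟩
    | x :: y :: l, h =>
      have := hf.two_le_norm h
      omega
  have := key _ (isReduced_toWord (x := w))
  rw [mk_toWord] at this
  exact this hg

end FreeGroupMetric

end PuncturedTorus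

/-! ### Nielsen moves, primitive classes and the words of the tree. -/

namespace PuncturedTorus

open FreeGroup (of)

/-! ### Nielsen moves -/

/-- A property of pairs which is stable under Nielsen moves and simultaneous conjugation. -/
structure MoveClosed (P : Gam → Gam → Prop) : Prop where
  swap : ∀ {u v}, P u v → P v u
  inv : ∀ {u v}, P u v → P u v⁻¹
  mul : ∀ {u v}, P u v → P u (u * v)
  conj : ∀ {u v} (g : Gam), P u v → P (g * u * g⁻¹) (g * v * g⁻¹)

namespace MoveClosed

variable {P : Gam → Gam → Prop}

theorem inv_left (h : MoveClosed P) {u v : Gam} (huv : P u v) : P u⁻¹ v :=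
  h.swap (h.inv (h.swap huv))

theorem inv_iff (h : MoveClosed P) {u v : Gam} : P u v⁻¹ ↔ P u v :=
  ⟨fun huv => by simpa using h.inv huv, h.inv⟩

theorem inv_left_iff (h : MoveClosed P) {u v : Gam} : P u⁻¹ v ↔ P u v :=
  ⟨fun huv => by simpa using h.inv_left huv, h.inv_left⟩

theorem mul_iff (h : MoveClosed P) {u v : Gam} : P u (u * v) ↔ P u v :=
  ⟨fun huv => by simpa using h.inv_left (h.mul (h.inv_left huv)), h.mul⟩

theorem mul_left_iff (h : MoveClosed P) {u v : Gam} : P (u * v) v ↔ P u v := by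
  have e : ∀ {u v}, P u v → P (u * v) v := fun {u v} huv => by
    have := h.mul (h.inv (h.inv_left (h.swap huv)))
    exact h.swap (by simpa using h.inv (h.inv_left this))
  exact ⟨fun huv => by simpa using h.inv (e (h.inv huv)), e⟩

theorem conj_iff (h : MoveClosed P) {u v : Gam} (g : Gam) :
    P (g * u * g⁻¹) (g * v * g⁻¹) ↔ P u v := by
  refine ⟨fun huv => ?_, h.conj g⟩
  have := h.conj g⁻¹ huv
  simpa [mul_assoc] using this

theorem swap_iff (h : MoveClosed P) {u v : Gam} : P v u ↔ P u v := ⟨h.swap, h.swap⟩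

theorem letter_iff (h : MoveClosed P) (f : Fin 2 → Gam) {x y : Fin 2 × Bool}
    (hxy : x.1 ≠ y.1) : P (letter f x) (letter f y) ↔ P (f 0) (f 1) := by
  have e : ∀ x y : Fin 2 × Bool, P (letter f x) (letter f y) ↔ P (f x.1) (f y.1) := by
    rintro ⟨i, _ | _⟩ ⟨j, _ | _⟩ <;> simp [letter, h.inv_iff, h.inv_left_iff]
  rw [e]
  obtain ⟨i, b⟩ := x
  obtain ⟨j, c⟩ := y
  fin_cases i <;> fin_cases j <;> simp_all [h.swap_iff]

end MoveClosed

/-! ### Free pairs -/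

theorem letter_eq_inv {ι : Type*} (f : ι → Gam) {z y : ι × Bool} (h1 : z.1 = y.1)
    (h2 : z.2 ≠ y.2) : letter f y = (letter f z)⁻¹ := by
  obtain ⟨i, b⟩ := z
  obtain ⟨j, c⟩ := y
  simp only at h1 h2
  subst h1
  cases b <;> cases c <;> simp [letter] at h2 ⊢

theorem isFreePair_of_inverse (φ ψ : Gam →* Gam) (h1 : φ.comp ψ = MonoidHom.id _)
    (h2 : ψ.comp φ = MonoidHom.id _) : IsFreePair (φ (of 0)) (φ (of 1)) := by
  have e : FreeGroup.lift ![φ (of 0), φ (of 1)] = φ := by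
    ext i; fin_cases i <;> simp
  rw [IsFreePair, e]
  exact Function.bijective_iff_has_inverse.mpr
    ⟨ψ, fun x => DFunLike.congr_fun h2 x, fun x => DFunLike.congr_fun h1 x⟩

theorem IsFreePair.comp {u v x y : Gam} (h : IsFreePair u v) (hxy : IsFreePair x y) :
    IsFreePair (FreeGroup.lift ![u, v] x) (FreeGroup.lift ![u, v] y) := by
  have e : FreeGroup.lift ![FreeGroup.lift ![u, v] x, FreeGroup.lift ![u, v] y] =
      (FreeGroup.lift ![u, v]).comp (FreeGroup.lift ![x, y]) := by
    ext i; fin_cases i <;> simp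
  rw [IsFreePair, e, MonoidHom.coe_comp]
  exact Function.Bijective.comp h hxy

theorem isFreePair_of : IsFreePair (of 0) (of 1) :=
  isFreePair_of_inverse (MonoidHom.id _) (MonoidHom.id _) rfl rfl

theorem moveClosed_isFreePair : MoveClosed IsFreePair where
  swap {u v} h := by
    have h1 := isFreePair_of_inverse (FreeGroup.lift ![of 1, of 0]) (FreeGroup.lift ![of 1, of 0])
      (by ext i; fin_cases i <;> simp) (by ext i; fin_cases i <;> simp)
    simpa using h.comp h1
  inv {u v} h := by
    have h1 := isFreePair_of_inverse (FreeGroup.lift ![of 0, (of 1)⁻¹])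
      (FreeGroup.lift ![of 0, (of 1)⁻¹])
      (by ext i; fin_cases i <;> simp) (by ext i; fin_cases i <;> simp)
    simpa using h.comp h1
  mul {u v} h := by
    have h1 := isFreePair_of_inverse (FreeGroup.lift ![of 0, of 0 * of 1])
      (FreeGroup.lift ![of 0, (of 0)⁻¹ * of 1])
      (by ext i; fin_cases i <;> simp) (by ext i; fin_cases i <;> simp)
    simpa using h.comp h1
  conj {u v} g h := by
    have e : FreeGroup.lift ![g * u * g⁻¹, g * v * g⁻¹] =
        (MulAut.conj g).toMonoidHom.comp (FreeGroup.lift ![u, v]) := by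
      ext i; fin_cases i <;> simp
    rw [IsFreePair, e, MonoidHom.coe_comp]
    exact (MulAut.conj g).bijective.comp h

theorem IsFreePair.letter_ne_one {u v : Gam} (h : IsFreePair u v) (x : Fin 2 × Bool) :
    letter ![u, v] x ≠ 1 := by
  have h1 : ∀ i : Fin 2, ![u, v] i ≠ 1 := fun i hi => by
    have : FreeGroup.lift ![u, v] (of i) = FreeGroup.lift ![u, v] 1 := by simpa using hi
    exact FreeGroup.of_ne_one i (h.1 this)
  obtain ⟨i, _ | _⟩ := x <;> simpa [letter] using h1 i

/-- Nielsen's theorem for the free group of rank two: free pairs are connected to the standard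
one by Nielsen moves and conjugations. -/
theorem MoveClosed.of_isFreePair {P : Gam → Gam → Prop} (hP : MoveClosed P)
    (h0 : P (of 0) (of 1)) {u v : Gam} (h : IsFreePair u v) : P u v := by
  induction hn : FreeGroup.norm u + FreeGroup.norm v using Nat.strong_induction_on
    generalizing u v with
  | _ n ih =>
  by_contra hneg
  set f : Fin 2 → Gam := ![u, v] with hf
  have hpos : ∀ x, 0 < FreeGroup.norm (letter f x) := fun x =>
    Nat.pos_of_ne_zero fun hx => h.letter_ne_one x (FreeGroup.norm_eq_zero.mp hx)
  have hsum : ∀ x y : Fin 2 × Bool, x.1 ≠ y.1 →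
      FreeGroup.norm (letter f x) + FreeGroup.norm (letter f y) = n := by
    have e : ∀ x : Fin 2 × Bool, FreeGroup.norm (letter f x) = FreeGroup.norm (f x.1) := by
      rintro ⟨i, _ | _⟩ <;> simp [letter]
    rintro ⟨i, b⟩ ⟨j, c⟩ hij
    rw [e, e, ← hn]
    fin_cases i <;> fin_cases j <;> simp_all [add_comm]
  -- No pair obtained by moves is shorter, since the induction would apply to it. The equivalence
  -- for all Q is used both for `IsFreePair` and for P.
  have hmin : ∀ x y : Fin 2 × Bool, x.1 ≠ y.1 → ∀ u' v',
      (∀ Q, MoveClosed Q → (Q u' v' ↔ Q (letter f x) (letter f y))) →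
        n ≤ FreeGroup.norm u' + FreeGroup.norm v' := by
    intro x y hxy u' v' hQ
    by_contra! hlt
    have h1 : IsFreePair u' v' :=
      (hQ _ moveClosed_isFreePair).mpr ((moveClosed_isFreePair.letter_iff f hxy).mpr h)
    exact hneg ((hP.letter_iff f hxy).mp ((hQ P hP).mp (ih _ hlt h1 rfl)))
  -- Replacing either letter by the product does not shorten the pair, so at most half of each
  -- letter cancels.
  have hN1 : ∀ x y : Fin 2 × Bool, x.1 ≠ y.1 →
      2 * overlap (letter f x)⁻¹ (letter f y) ≤ FreeGroup.norm (letter f x) ∧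
      2 * overlap (letter f x)⁻¹ (letter f y) ≤ FreeGroup.norm (letter f y) := by
    intro x y hxy
    have h1 := hmin x y hxy _ _ fun Q hQ => hQ.mul_iff
    have h2 := hmin x y hxy _ _ fun Q hQ => hQ.mul_left_iff
    have h3 := hsum x y hxy
    have h4 := norm_mul_add_overlap (letter f x) (letter f y)
    omega
  have hbad : ∀ x z : Fin 2 × Bool, z.1 ≠ x.1 →
      2 * overlap (letter f z)⁻¹ (letter f x) = FreeGroup.norm (letter f x) →
      2 * overlap (letter f x)⁻¹ (letter f z) = FreeGroup.norm (letter f x) → False := by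
    intro x z hzx h1 h2
    obtain ⟨q, hq⟩ := exists_conj_shorter h1 h2 (h1 ▸ (hN1 z x hzx).1)
    have h3 := hmin z x hzx (q⁻¹ * letter f x * q) (q⁻¹ * (letter f z * letter f x) * q)
      fun Q hQ => by
      have := hQ.conj_iff (u := letter f x) (v := letter f z * letter f x) q⁻¹
      rw [inv_inv] at this
      rw [this, hQ.swap_iff, hQ.mul_left_iff]
    have := hsum z x hzx
    have := hpos x
    omega
  have hsame : ∀ z x : Fin 2 × Bool, FreeGroup.IsReduced [z, x] → z.1 = x.1 → z = x := by
    intro z x hzx h1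
    simp only [FreeGroup.IsReduced, List.isChain_cons_cons, List.isChain_singleton,
      and_true] at hzx
    exact Prod.ext h1 (hzx h1)
  have hself : ∀ x, 2 * overlap (letter f x)⁻¹ (letter f x) < FreeGroup.norm (letter f x) :=
    fun x => norm_lt_norm_mul_self (h.letter_ne_one x)
  have hred : NielsenReduced f := by
    refine ⟨fun z x hzx => ?_, fun z x y hzx hxy => ?_⟩
    · have := hpos x
      by_cases h1 : z.1 = x.1
      · rw [hsame z x hzx h1]
        have := hself x
        omega
      · have := hN1 z x h1
        omega
    · have hs := hself x
      by_cases h1 : z.1 = x.1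
      · rw [hsame z x hzx h1]
        by_cases h2 : x.1 = y.1
        · rw [← hsame x y hxy h2]
          omega
        · have := hN1 x y h2
          omega
      · have a1 := hN1 z x h1
        by_cases h2 : x.1 = y.1
        · rw [← hsame x y hxy h2]
          omega
        · have a2 := hN1 x y h2
          -- The critical case: exactly half of x cancels on each side. If the neighbours are equal,
          -- `hbad` shortens the pair by a conjugation; if they are inverse, half of x would cancel
          -- against x itself.
          by_contra! hge
          have hzy : z.1 = y.1 := by omega
          by_cases h3 : z.2 = y.2
          · obtain rfl : z = y := Prod.ext hzy h3
            exact hbad x z h1 (by omega) (by omega)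
          · have hinv := letter_eq_inv f hzy h3
            rw [hinv] at hge a2
            have := min_overlap_le (letter f x) (letter f z)⁻¹ (letter f x)⁻¹
            rw [overlap_comm (letter f x), overlap_comm (letter f x) (letter f x)⁻¹,
              overlap_comm (letter f z)⁻¹ (letter f x)⁻¹] at this
            omega
  -- In a reduced generating pair only single letters have norm one, so the standard generators are
  -- letters of the pair.
  obtain ⟨x, hx⟩ := hred.exists_letter h.2 (FreeGroup.norm_of (0 : Fin 2))
  obtain ⟨y, hy⟩ := hred.exists_letter h.2 (FreeGroup.norm_of (1 : Fin 2))
  have hxy : x.1 ≠ y.1 := by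
    intro hxy
    have : letter f x = letter f y ∨ letter f x = (letter f y)⁻¹ := by
      by_cases h2 : x.2 = y.2
      · rw [show x = y from Prod.ext hxy h2]
        exact Or.inl rfl
      · exact Or.inr (letter_eq_inv f hxy.symm (Ne.symm h2))
    rw [hx, hy] at this
    revert this
    decide
  rw [← hx, ← hy] at h0
  exact hneg ((hP.letter_iff f hxy).mp h0)

/-! ### Primitive words -/

/-- The product of a tree of words: the word beyond a pair along a binary word. -/
def treeWord : Gam → Gam → List Bool → Gam
  | u, v, [] => u * v
  | u, v, false :: w => treeWord u (u * v) w
  | u, v, true :: w => treeWord (u * v) v w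

/-- The pairs of neighbouring words in the tree. -/
inductive TreePair : Gam → Gam → Prop
  | pos : TreePair (of 0) (of 1)
  | neg : TreePair (of 0) (of 1)⁻¹
  | left {u v : Gam} : TreePair u v → TreePair u (u * v)
  | right {u v : Gam} : TreePair u v → TreePair (u * v) v

/-- Equality up to inversion. -/
def SignEq (x y : Gam) : Prop := x = y ∨ x = y⁻¹

theorem SignEq.inv {x y : Gam} (h : SignEq x y) : SignEq x⁻¹ y := by
  rcases h with rfl | rfl
  · exact Or.inr rfl
  · exact Or.inl (inv_inv y)

theorem SignEq.refl (x : Gam) : SignEq x x := Or.inl rfl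

/-- The pair is a pair of neighbouring words up to conjugation, inversions and order. -/
def NearTree (u v : Gam) : Prop :=
  ∃ u' v' g, TreePair u' v' ∧ ((SignEq (g * u * g⁻¹) u' ∧ SignEq (g * v * g⁻¹) v') ∨
    (SignEq (g * u * g⁻¹) v' ∧ SignEq (g * v * g⁻¹) u'))

namespace NearTree

theorem of_treePair {u v : Gam} (h : TreePair u v) : NearTree u v :=
  ⟨u, v, 1, h, Or.inl ⟨by simp [SignEq.refl], by simp [SignEq.refl]⟩⟩

theorem swap {u v : Gam} : NearTree u v → NearTree v u := by
  rintro ⟨u', v', g, h, ⟨h1, h2⟩ | ⟨h1, h2⟩⟩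
  · exact ⟨u', v', g, h, Or.inr ⟨h2, h1⟩⟩
  · exact ⟨u', v', g, h, Or.inl ⟨h2, h1⟩⟩

theorem inv {u v : Gam} : NearTree u v → NearTree u v⁻¹ := by
  have e : ∀ g : Gam, g * v⁻¹ * g⁻¹ = (g * v * g⁻¹)⁻¹ := fun g => by group
  rintro ⟨u', v', g, h, ⟨h1, h2⟩ | ⟨h1, h2⟩⟩
  · exact ⟨u', v', g, h, Or.inl ⟨h1, e g ▸ h2.inv⟩⟩
  · exact ⟨u', v', g, h, Or.inr ⟨h1, e g ▸ h2.inv⟩⟩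

theorem conj {u v : Gam} (k : Gam) : NearTree u v → NearTree (k * u * k⁻¹) (k * v * k⁻¹) := by
  have e : ∀ g w : Gam, g * k⁻¹ * (k * w * k⁻¹) * (g * k⁻¹)⁻¹ = g * w * g⁻¹ :=
    fun g w => by group
  rintro ⟨u', v', g, h, h1⟩
  refine ⟨u', v', g * k⁻¹, h, ?_⟩
  rwa [e, e]

theorem inv_left {u v : Gam} (h : NearTree u v) : NearTree u⁻¹ v := h.swap.inv.swap

theorem of_conj {u v : Gam} (k : Gam) (h : NearTree (k * u * k⁻¹) (k * v * k⁻¹)) :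
    NearTree u v := by
  have := h.conj k⁻¹
  simpa [mul_assoc] using this

/-- Passing to uv⁻¹ goes backwards: it undoes the last step up to conjugation, and at the initial
edge it crosses between the pairs with b and with b⁻¹. -/
theorem div {u v : Gam} (h : TreePair u v) :
    NearTree u (u * v⁻¹) ∧ NearTree v (u * v⁻¹) := by
  cases h with
  | pos => exact ⟨of_treePair (.left .neg), by simpa using (of_treePair (.right .neg)).swap.inv_left⟩
  | neg =>
    rw [inv_inv]
    exact ⟨of_treePair (.left .pos), (of_treePair (.right .pos)).swap.inv_left⟩
  | left h =>
    rename_i v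
    constructor
    · apply of_conj u⁻¹
      have := (of_treePair h).inv
      simpa [mul_assoc] using this
    · apply of_conj (v⁻¹ * u⁻¹)
      have := (of_treePair (.right h)).inv
      simpa [mul_assoc] using this
  | right h =>
    rename_i u
    rw [mul_inv_cancel_right]
    exact ⟨(of_treePair (.left h)).swap, (of_treePair h).swap⟩

/-- Equal signs lead forwards in the tree and opposite signs backwards through `div`; conjugations
correct the order of the factors. -/
theorem mul_of_treePair {u v u' v' : Gam} (h : TreePair u' v') (h1 : SignEq u u')
    (h2 : SignEq v v') : NearTree u (u * v) ∧ NearTree v (v * u) := by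
  obtain ⟨d1, d2⟩ := div h
  have p1 : NearTree u' (u' * v') := of_treePair (.left h)
  have p2 : NearTree v' (u' * v') := (of_treePair (.right h)).swap
  have q1 : NearTree u' (v' * u') := of_conj u' (by simpa [mul_assoc] using p1)
  have q2 : NearTree v' (v' * u') := of_conj v'⁻¹ (by simpa [mul_assoc] using p2)
  have r1 : NearTree u' (v'⁻¹ * u') := of_conj u' (by simpa [mul_assoc] using d1)
  have r2 : NearTree v' (v'⁻¹ * u') := of_conj v' (by simpa [mul_assoc] using d2)
  rcases h1 with rfl | rfl <;> rcases h2 with rfl | rfl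
  · exact ⟨p1, q2⟩
  · exact ⟨d1, r2.inv_left⟩
  · exact ⟨by simpa using r1.inv_left.inv, by simpa using d2.inv⟩
  · exact ⟨by simpa using q1.inv_left.inv, by simpa using p2.inv_left.inv⟩

theorem mul {u v : Gam} : NearTree u v → NearTree u (u * v) := by
  rintro ⟨u', v', g, h, h1⟩
  apply of_conj g
  have e : g * (u * v) * g⁻¹ = g * u * g⁻¹ * (g * v * g⁻¹) := by group
  rw [e]
  rcases h1 with ⟨h1, h2⟩ | ⟨h1, h2⟩
  · exact (mul_of_treePair h h1 h2).1
  · exact (mul_of_treePair h h2 h1).2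

theorem moveClosed : MoveClosed NearTree := ⟨swap, inv, mul, conj⟩

end NearTree

/-- A representative of the simple closed curves in a region. -/
def TreeRegion.word : TreeRegion → Gam
  | Sum.inl (Sum.inl _) => of 0
  | Sum.inl (Sum.inr _) => of 1
  | Sum.inr (Sum.inl w) => treeWord (of 0) (of 1) w
  | Sum.inr (Sum.inr w) => treeWord (of 0) (of 1)⁻¹ w

theorem TreePair.exists_word {u v : Gam} (h : TreePair u v) :
    (∃ i : TreeRegion, SignEq u i.word) ∧ ∃ i : TreeRegion, SignEq v i.word := by
  -- The clause on `treeWord` makes the induction work: the new member of a pair is the word at `[]`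
  -- of the previous pair.
  have key : (∃ i : TreeRegion, SignEq u i.word) ∧ (∃ i : TreeRegion, SignEq v i.word) ∧
      ∀ w, ∃ i : TreeRegion, treeWord u v w = i.word := by
    induction h with
    | pos =>
      exact ⟨⟨Sum.inl (Sum.inl ()), .refl _⟩, ⟨Sum.inl (Sum.inr ()), .refl _⟩,
        fun w => ⟨Sum.inr (Sum.inl w), rfl⟩⟩
    | neg =>
      exact ⟨⟨Sum.inl (Sum.inl ()), .refl _⟩, ⟨Sum.inl (Sum.inr ()), (SignEq.refl _).inv⟩,
        fun w => ⟨Sum.inr (Sum.inr w), rfl⟩⟩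
    | left _ ih =>
      obtain ⟨h1, -, h3⟩ := ih
      obtain ⟨i, hi⟩ := h3 []
      exact ⟨h1, ⟨i, Or.inl hi⟩, fun w => h3 (false :: w)⟩
    | right _ ih =>
      obtain ⟨-, h2, h3⟩ := ih
      obtain ⟨i, hi⟩ := h3 []
      exact ⟨⟨i, Or.inl hi⟩, h2, fun w => h3 (true :: w)⟩
  exact ⟨key.1, key.2.1⟩

theorem mk_eq_of_signEq_conj {u v g : Gam} (h : SignEq (g * u * g⁻¹) v) :
    Quotient.mk curveSetoid u = Quotient.mk curveSetoid v := by
  apply Quotient.sound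
  rcases h with h | h
  · exact Or.inl (isConj_iff.mpr ⟨g, h⟩)
  · exact Or.inr (isConj_iff.mpr ⟨g, h⟩)

/-- Every primitive class is represented by one of the words of the tree. -/
theorem IsFreePair.exists_word {u v : Gam} (h : IsFreePair u v) :
    ∃ i : TreeRegion, Quotient.mk curveSetoid u = Quotient.mk curveSetoid i.word := by
  obtain ⟨u', v', g, ht, h1⟩ :=
    NearTree.moveClosed.of_isFreePair (NearTree.of_treePair .pos) h
  obtain ⟨⟨i, hi⟩, ⟨j, hj⟩⟩ := ht.exists_word
  have trans : ∀ {x y z : Gam}, SignEq x y → SignEq y z → SignEq x z := by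
    rintro x y z (rfl | rfl) h
    · exact h
    · exact h.inv
  rcases h1 with ⟨h1, -⟩ | ⟨h1, -⟩
  · exact ⟨i, mk_eq_of_signEq_conj (trans h1 hi)⟩
  · exact ⟨j, mk_eq_of_signEq_conj (trans h1 hj)⟩

theorem IsFreePair.treeWord {u v : Gam} (h : IsFreePair u v) (w : List Bool) :
    ∃ y, IsFreePair (treeWord u v w) y := by
  induction w generalizing u v with
  | nil => exact ⟨v, moveClosed_isFreePair.mul_left_iff.mpr h⟩
  | cons d w ih =>
    cases d
    · exact ih (moveClosed_isFreePair.mul h)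
    · exact ih (moveClosed_isFreePair.mul_left_iff.mpr h)

theorem TreeRegion.exists_isFreePair (i : TreeRegion) : ∃ y, IsFreePair i.word y := by
  rcases i with (_ | _) | (w | w)
  · exact ⟨_, isFreePair_of⟩
  · exact ⟨_, moveClosed_isFreePair.swap isFreePair_of⟩
  · exact isFreePair_of.treeWord w
  · exact (moveClosed_isFreePair.inv isFreePair_of).treeWord w

/-! ### Homology classes -/

/-- The abelianization of the free group. -/
def homology : Gam →* Multiplicative (ℤ × ℤ) :=
  FreeGroup.lift ![Multiplicative.ofAdd (1, 0), Multiplicative.ofAdd (0, 1)]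

theorem homology_treeWord (u v : Gam) (w : List Bool) :
    (homology (treeWord u v w)).toAdd =
      ((farey w).1 : ℤ) • (homology u).toAdd + ((farey w).2 : ℤ) • (homology v).toAdd := by
  induction w generalizing u v with
  | nil => simp [treeWord, farey]
  | cons d w ih =>
    cases d <;> rw [treeWord, ih, map_mul, toAdd_mul] <;> simp only [farey] <;> push_cast <;>
      module

theorem homology_word (i : TreeRegion) : (homology i.word).toAdd = i.vec := by
  have h0 : (homology (of 0)).toAdd = (1, 0) := by simp [homology]
  have h1 : (homology (of 1)).toAdd = (0, 1) := by simp [homology]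
  rcases i with (_ | _) | (w | w)
  · exact h0
  · exact h1
  · rw [TreeRegion.word, homology_treeWord, h0, h1]
    simp [TreeRegion.vec]
  · rw [TreeRegion.word, homology_treeWord, map_inv, toAdd_inv, h0, h1]
    simp [TreeRegion.vec]

theorem homology_eq_of_mk_eq {g h : Gam}
    (hgh : Quotient.mk curveSetoid g = Quotient.mk curveSetoid h) :
    (homology g).toAdd = (homology h).toAdd ∨ (homology g).toAdd = -(homology h).toAdd := by
  have conj : ∀ {x y : Gam}, IsConj x y → homology x = homology y := fun hxy =>
    isConj_iff_eq.mp (homology.map_isConj hxy)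
  rcases Quotient.exact hgh with hc | hc
  · exact Or.inl (by rw [conj hc])
  · exact Or.inr (by rw [conj hc, map_inv, toAdd_inv])

/-- Homology is invariant under conjugation and changes sign under inversion, and distinct regions
have distinct vectors up to sign. -/
theorem mk_word_injective :
    Function.Injective fun i : TreeRegion => Quotient.mk curveSetoid i.word := by
  intro i j hij
  have := homology_eq_of_mk_eq hij
  rw [homology_word, homology_word] at this
  exact TreeRegion.vec_injective_up_to_sign this

end PuncturedTorus

/-! ### Traces of representations and the conclusion. -/

namespace PuncturedTorus

open FreeGroup (of)

/-! ### Traces -/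

/-- The trace of a representation. -/
def repTrace (ρ : Gam →* Matrix.SpecialLinearGroup (Fin 2) ℂ) (g : Gam) : ℂ :=
  (ρ g : Matrix (Fin 2) (Fin 2) ℂ).trace

section Trace

variable (ρ : Gam →* Matrix.SpecialLinearGroup (Fin 2) ℂ)

theorem repTrace_one : repTrace ρ 1 = 2 := by
  simp [repTrace]

theorem repTrace_mul_comm (g h : Gam) : repTrace ρ (g * h) = repTrace ρ (h * g) := by
  rw [repTrace, map_mul, Matrix.SpecialLinearGroup.coe_mul, Matrix.trace_mul_comm, repTrace,
    map_mul, Matrix.SpecialLinearGroup.coe_mul]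

theorem repTrace_inv (g : Gam) : repTrace ρ g⁻¹ = repTrace ρ g := by
  rw [repTrace, map_inv, Matrix.SpecialLinearGroup.coe_inv, Matrix.adjugate_fin_two, repTrace,
    Matrix.trace_fin_two, Matrix.trace_fin_two]
  simp [add_comm]

/-- By Cayley–Hamilton, h + h⁻¹ is the scalar tr h in SL(2). This is the edge relation. -/
theorem repTrace_mul_add (g h : Gam) :
    repTrace ρ (g * h) + repTrace ρ (g * h⁻¹) = repTrace ρ g * repTrace ρ h := by
  simp only [repTrace, map_mul, map_inv, Matrix.SpecialLinearGroup.coe_mul,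
    Matrix.SpecialLinearGroup.coe_inv, Matrix.adjugate_fin_two, Matrix.trace_fin_two,
    Matrix.mul_apply, Fin.sum_univ_two]
  simp
  ring

/-- Fricke's identity, written with gh⁻¹ because that is the value behind the edge; it is the vertex
relation for μ = τ + 2. -/
theorem repTrace_commutator (g h : Gam) : repTrace ρ (g * h * g⁻¹ * h⁻¹) =
    repTrace ρ g ^ 2 + repTrace ρ h ^ 2 + repTrace ρ (g * h⁻¹) ^ 2 -
      repTrace ρ g * repTrace ρ h * repTrace ρ (g * h⁻¹) - 2 := by
  have h1 := repTrace_mul_add ρ (g * h * g⁻¹) h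
  have h2 := repTrace_mul_add ρ (g * h) (g⁻¹ * h)
  have h3 := repTrace_mul_add ρ g g
  have h4 := repTrace_mul_add ρ g h
  have e1 : repTrace ρ (g * h * g⁻¹) = repTrace ρ h := by
    rw [repTrace_mul_comm, ← mul_assoc, inv_mul_cancel, one_mul]
  have e2 : g * h * (g⁻¹ * h)⁻¹ = g * g := by group
  have e3 : repTrace ρ (g⁻¹ * h) = repTrace ρ (g * h⁻¹) := by
    rw [← repTrace_inv, mul_inv_rev, inv_inv, repTrace_mul_comm]
  rw [e1] at h1
  rw [e2, e3, ← mul_assoc (g * h)] at h2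
  rw [mul_inv_cancel, repTrace_one] at h3
  linear_combination h1 - h2 + h3 - repTrace ρ (g * h⁻¹) * h4

/-- The edge of the tree along the curves `u` and `v`. -/
def repEdge (u v : Gam) : Edge := ⟨repTrace ρ u, repTrace ρ v, repTrace ρ (u * v⁻¹)⟩

theorem repEdge_front (u v : Gam) : (repEdge ρ u v).front = repTrace ρ (u * v) := by
  simp only [repEdge, Edge.front]
  linear_combination -repTrace_mul_add ρ u v

theorem repEdge_val (u v : Gam) (w : List Bool) :
    (repEdge ρ u v).val w = repTrace ρ (treeWord u v w) := by
  induction w generalizing u v with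
  | nil => exact repEdge_front ρ u v
  | cons d w ih =>
    cases d
    · have : (repEdge ρ u v).child false = repEdge ρ u (u * v) := by
        have e : repTrace ρ (u * (u * v)⁻¹) = repTrace ρ v := by
          rw [repTrace_mul_comm, mul_inv_rev, inv_mul_cancel_right, repTrace_inv]
        rw [Edge.child, repEdge_front, repEdge, repEdge, e]
      rw [Edge.val_cons, this, ih, treeWord]
    · have : (repEdge ρ u v).child true = repEdge ρ (u * v) v := by
        rw [Edge.child, repEdge_front, repEdge, repEdge, mul_inv_cancel_right]
      rw [Edge.val_cons, this, ih, treeWord]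

theorem repEdge_value (i : TreeRegion) :
    (repEdge ρ (of 0) (of 1)).value i = repTrace ρ i.word := by
  have hrev : (repEdge ρ (of 0) (of 1)).reverse = repEdge ρ (of 0) (of 1)⁻¹ := by
    rw [Edge.reverse, repEdge_front, repEdge, repEdge, inv_inv, repTrace_inv]
  rcases i with (_ | _) | (w | w)
  · rfl
  · rfl
  · exact repEdge_val ρ _ _ w
  · rw [Edge.value, hrev, repEdge_val]; rfl

end Trace

theorem mk_map_eq (θ : Gam →* Gam) {g h : Gam}
    (hgh : Quotient.mk curveSetoid g = Quotient.mk curveSetoid h) :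
    Quotient.mk curveSetoid (θ g) = Quotient.mk curveSetoid (θ h) := by
  apply Quotient.sound
  rcases Quotient.exact hgh with hc | hc
  · exact Or.inl (θ.map_isConj hc)
  · exact Or.inr (map_inv θ h ▸ θ.map_isConj hc)

/-- The regions of the tree correspond to the simple closed curves. -/
theorem exists_equiv_simpleClasses {a b : Gam} (hab : IsFreePair a b) :
    ∃ σ : TreeRegion ≃ simpleClasses, ∀ i,
      (σ i : CurveClass) = Quotient.mk curveSetoid (FreeGroup.lift ![a, b] i.word) := by
  let θ : Gam ≃* Gam := MulEquiv.ofBijective (FreeGroup.lift ![a, b]) hab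
  let F : TreeRegion → simpleClasses := fun i =>
    ⟨Quotient.mk curveSetoid (FreeGroup.lift ![a, b] i.word), by
      obtain ⟨y, hy⟩ := i.exists_isFreePair
      exact ⟨_, _, hab.comp hy, rfl⟩⟩
  have hF : Function.Bijective F := by
    refine ⟨fun i j hij => ?_, fun c => ?_⟩
    · have h1 := mk_map_eq θ.symm.toMonoidHom (congrArg Subtype.val hij)
      have e : ∀ g, θ.symm.toMonoidHom (FreeGroup.lift ![a, b] g) = g := θ.symm_apply_apply
      rw [e, e] at h1
      exact mk_word_injective h1
    · obtain ⟨c, x, y, hxy, rfl⟩ := c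
      have h1 : IsFreePair (θ.symm x) (θ.symm y) := by
        have e : FreeGroup.lift ![θ.symm x, θ.symm y] =
            θ.symm.toMonoidHom.comp (FreeGroup.lift ![x, y]) := by
          ext i; fin_cases i <;> simp
        rw [IsFreePair, e, MonoidHom.coe_comp]
        exact θ.symm.bijective.comp hxy
      obtain ⟨i, hi⟩ := h1.exists_word
      refine ⟨i, Subtype.ext ?_⟩
      have h2 := mk_map_eq (FreeGroup.lift ![a, b]) hi
      have e : FreeGroup.lift ![a, b] (θ.symm x) = x := θ.apply_symm_apply x
      rw [e] at h2
      exact h2.symm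
  exact ⟨Equiv.ofBijective F hF, fun _ => rfl⟩

/-- The gap identity for representations of the punctured torus group. -/
theorem rep_gap_identity {τ : ℂ} {ρ : Gam →* Matrix.SpecialLinearGroup (Fin 2) ℂ} (hτ : τ ≠ 2)
    (hρ : IsTauRep τ ρ) (hBQ : RepBQ ρ) :
    (∀ c ∈ simpleClasses, classTrace ρ c ^ 2 ≠ τ + 2) ∧
      Summable (fun c : simpleClasses => ‖gap τ (classTrace ρ c)‖) ∧
      ∃ k : ℤ, HasSum (fun c : simpleClasses => gap τ (classTrace ρ c))
        (nu τ + 2 * (Real.pi : ℂ) * Complex.I * (k : ℂ)) := by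
  obtain ⟨a, b, hab, htr⟩ := hρ
  obtain ⟨σ, hσ⟩ := exists_equiv_simpleClasses hab
  -- The automorphism moves a, b to the standard generators, where the words of the tree live, so
  -- the commutator trace is needed for this one pair only.
  set ρ' := ρ.comp (FreeGroup.lift ![a, b]) with hρ'
  set e := repEdge ρ' (of 0) (of 1) with he
  have hval : ∀ i, e.value i = classTrace ρ (σ i) := by
    intro i
    rw [he, repEdge_value, hσ]
    rfl
  have hv : e.Vertex (τ + 2) := by
    have h1 := repTrace_commutator ρ' (of 0) (of 1)
    have h2 : repTrace ρ' (of 0 * of 1 * (of 0)⁻¹ * (of 1)⁻¹) = τ := by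
      rw [← htr, repTrace, hρ']
      simp
    rw [h2] at h1
    unfold Edge.Vertex
    simp only [he, repEdge]
    linear_combination -h1
  obtain ⟨h1, h2, k, h3⟩ := Edge.gap_identity hτ hv
    (fun i => by rw [hval]; exact hBQ.1 _ (σ i).2) (by
      simp only [hval]
      refine (hBQ.2.preimage (f := fun i => (σ i : CurveClass))
        (Subtype.val_injective.comp σ.injective).injOn).subset fun i hi => ⟨(σ i).2, hi⟩)
  simp only [hval] at h1 h2 h3
  refine ⟨fun c hc => ?_, ?_, k, ?_⟩
  · have := h1 (σ.symm ⟨c, hc⟩)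
    rwa [σ.apply_symm_apply] at this
  · exact σ.summable_iff.mp h2
  · exact σ.hasSum_iff.mp h3

end PuncturedTorus

open PuncturedTorus
theorem theorem2p2 :
    (∀ (τ : ℂ) (ρ : Gam →* Matrix.SpecialLinearGroup (Fin 2) ℂ),
      τ ≠ 2 → IsTauRep τ ρ → RepBQ ρ →
        (∀ c ∈ simpleClasses, classTrace ρ c ^ 2 ≠ τ + 2) ∧
        Summable (fun c : simpleClasses => ‖gap τ (classTrace ρ c)‖) ∧
        ∃ k : ℤ, HasSum (fun c : simpleClasses => gap τ (classTrace ρ c))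
          (nu τ + 2 * (Real.pi : ℂ) * Complex.I * (k : ℂ))) ∧
    (∀ (μ : ℂ) (φ : Region → ℂ),
      μ ≠ 0 → μ ≠ 4 → IsMarkoffMap μ φ → MarkoffBQ φ →
        (∀ X, φ X ^ 2 ≠ μ) ∧
        Summable (fun X : Region => ‖gap (μ - 2) (φ X)‖) ∧
        ∃ k : ℤ, HasSum (fun X : Region => gap (μ - 2) (φ X))
          (arcosh (1 - μ / 2) + 2 * (Real.pi : ℂ) * Complex.I * (k : ℂ))) := by
  refine ⟨fun τ ρ hτ hρ hBQ => rep_gap_identity hτ hρ hBQ, fun μ φ _ hμ hφ hBQ => ?_⟩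
  have e : arcosh (1 - μ / 2) = nu (μ - 2) := by
    rw [nu]; congr 1; ring
  rw [e]
  exact markoff_gap_identity hμ hφ hBQ
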